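/- Let $\mathbb{T}^3=\mathbb{R}^3/(2\pi\mathbb{Z})^3$, with Lebesgue measure of total mass $(2\pi)^3$. Let $\varepsilon_1,\varepsilon_2:\mathbb{T}^3\to\mathbb{R}$ be twice differentiable functions, each with a unique non-degenerate minimum at the origin, and each conditionally negative definite, that is, $\varepsilon_\alpha(-p)=\varepsilon_\alpha(p)$ and $$\sum_{i,j=1}^{n}\varepsilon_\alpha(p_i-p_j)z_i\overline{z_j}\le 0\qquad\text{for all } n,\ p_1,\dots,p_n\in\mathbb{T}^3,\ z\in\mathbb{C}^n \text{ with } \sum_{i} z_i=0 .$$ Let $v:\mathbb{T}^3\to\mathbb{C}$ be continuous with $v(p)=\overline{v(-p)}$. For $k\in\mathbb{T}^3$ put $\mathcal{E}_k(p)=\varepsilon_1(p)+\varepsilon_2(k-p)$ and $\mathcal{E}_{\min}(k)=\min_{p}\mathcal{E}_k(p)$, and let $h(k)$ be the bounded self-adjoint operator on $L^2(\mathbb{T}^3)$ given by $$(h(k)f)(p)=\mathcal{E}_k(p)f(p)+(2\pi)^{-3/2}\int_{\mathbb{T}^3}v(p-q)f(q)\,dq .$$ Suppose that at least one of the following holds.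 (a) (threshold eigenvalue) $\mathcal{E}_0(0)=\mathcal{E}_{\min}(0)$ is an eigenvalue of $h(0)$. (b) (virtual level) There is a continuous function $\psi\neq 0$ on $\mathbb{T}^3$ with $$(2\pi)^{-3/2}\int_{\mathbb{T}^3}\frac{v(p-q)}{\mathcal{E}_0(q)-\mathcal{E}_0(0)}\,\psi(q)\,dq=-\psi(p)\quad\text{for all } p\in\mathbb{T}^3,\qquad \frac{\psi}{\mathcal{E}_0-\mathcal{E}_0(0)}\notin L^2(\mathbb{T}^3).$$ Then for every $k\in\mathbb{T}^3\setminus\{0\}$ the bottom of the essential spectrum of $h(k)$ is $\mathcal{E}_{\min}(k)$, and the discrete spectrum of $h(k)$ (the set of isolated points of the spectrum that are eigenvalues of finite multiplicity) contains a point below $\mathcal{E}_{\min}(k)$. Here the essential spectrum is the complement of the discrete spectrum in the spectrum. -/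

import Mathlib

namespace LatticeTwoBody

open MeasureTheory

noncomputable section

instance factTwoPiPos : Fact ((0 : ℝ) < 2 * Real.pi) := ⟨Real.two_pi_pos⟩

/-- The torus `𝕋³ = ℝ³ / (2πℤ)³`, an abelian group. Its `volume` is Lebesgue measure on
`(-π, π]³`, of total mass `(2π)³`. -/
abbrev Torus3 : Type := Fin 3 → AddCircle (2 * Real.pi)

/-- The Hilbert space `L²(𝕋³)`. -/
abbrev L2T : Type := Lp ℂ 2 (volume : Measure Torus3)

/-- The quotient map `ℝ³ → 𝕋³`. -/
def proj (x : Fin 3 → ℝ) : Torus3 := fun i => (x i : AddCircle (2 * Real.pi))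

/-- The `(2πℤ)³`-periodic function on `ℝ³` that corresponds to a function on the torus. -/
def lift (ε : Torus3 → ℝ) : (Fin 3 → ℝ) → ℝ := fun x => ε (proj x)

/-- `ε` is twice differentiable and has a unique non-degenerate minimum at the origin. -/
structure IsDispersion (ε : Torus3 → ℝ) : Prop where
  differentiable : Differentiable ℝ (lift ε)
  differentiable_fderiv : Differentiable ℝ (fderiv ℝ (lift ε))
  unique_min : ∀ p : Torus3, p ≠ 0 → ε 0 < ε p
  /-- The Hessian at the origin has trivial kernel. -/
  nondegenerate : ∀ u : Fin 3 → ℝ, fderiv ℝ (fderiv ℝ (lift ε)) 0 u = 0 → u = 0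

/-- Conditional negative definiteness of a real-valued function on the torus. As `ε` is even, the
double sum is a real number, so that `re` loses nothing. -/
def IsCondNegDef (ε : Torus3 → ℝ) : Prop :=
  (∀ p, ε (-p) = ε p) ∧
  ∀ (n : ℕ) (p : Fin n → Torus3) (z : Fin n → ℂ), ∑ i, z i = 0 →
    (∑ i, ∑ j, (ε (p i - p j) : ℂ) * z i * (starRingEnd ℂ) (z j)).re ≤ 0

/-- The operator of multiplication by the continuous real function `e` on `L²(𝕋³)`. -/
def mulOp (e : C(Torus3, ℝ)) : L2T →L[ℂ] L2T :=
  (ContinuousLinearMap.mul ℂ ℂ).holderL volume ⊤ 2 2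
    (ContinuousMap.toLp ⊤ volume ℂ ⟨fun p => (e p : ℂ), by fun_prop⟩)

theorem mulOp_ae (e : C(Torus3, ℝ)) (f : L2T) :
    mulOp e f =ᵐ[volume] fun p => (e p : ℂ) * f p := by
  have h1 := (ContinuousLinearMap.mul ℂ ℂ).coeFn_holder (r := 2)
    (ContinuousMap.toLp (E := ℂ) ⊤ (volume : Measure Torus3) ℂ
      ⟨fun p => (e p : ℂ), by fun_prop⟩) f
  have h2 := ContinuousMap.coeFn_toLp (E := ℂ) (p := ⊤) (𝕜 := ℂ) (volume : Measure Torus3)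
      ⟨fun p => (e p : ℂ), by fun_prop⟩
  refine Filter.EventuallyEq.trans h1 ?_
  filter_upwards [h2] with p hp
  rw [hp]
  rfl

/-- The function `q ↦ v (p - q)`. -/
def kernelFun (v : C(Torus3, ℂ)) (p : Torus3) : C(Torus3, ℂ) := ⟨fun q => v (p - q), by fun_prop⟩

theorem continuous_kernelFun (v : C(Torus3, ℂ)) : Continuous (kernelFun v) :=
  ContinuousMap.continuous_of_continuous_uncurry _
    (by simp only [kernelFun, Function.uncurry_def, ContinuousMap.coe_mk]; fun_prop)

/-- `f ↦ ∫ v (p - q) f (q) dq` as a bounded functional on `L²(𝕋³)`. -/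
def convAt (v : C(Torus3, ℂ)) (p : Torus3) : L2T →L[ℂ] ℂ :=
  (ContinuousLinearMap.mul ℂ ℂ).lpPairing volume 2 2
    (ContinuousMap.toLp 2 volume ℂ (kernelFun v p))

theorem convAt_eq (v : C(Torus3, ℂ)) (p : Torus3) (f : L2T) :
    convAt v p f = ∫ q, v (p - q) * f q := by
  rw [convAt, ContinuousLinearMap.lpPairing_eq_integral]
  refine integral_congr_ae ?_
  filter_upwards [ContinuousMap.coeFn_toLp (E := ℂ) (p := 2) (𝕜 := ℂ)
    (volume : Measure Torus3) (kernelFun v p)] with q hq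
  rw [hq]
  rfl

theorem continuous_convAt (v : C(Torus3, ℂ)) : Continuous (convAt v) :=
  (ContinuousLinearMap.continuous _).comp
    ((ContinuousLinearMap.continuous _).comp (continuous_kernelFun v))

/-- `f ↦ (p ↦ ∫ v (p - q) f (q) dq)` as a bounded operator from `L²(𝕋³)` to `C(𝕋³)`. -/
def convC (v : C(Torus3, ℂ)) : L2T →L[ℂ] C(Torus3, ℂ) :=
  LinearMap.mkContinuous
    { toFun := fun f => ⟨fun p => convAt v p f, (continuous_convAt v).clm_apply continuous_const⟩
      map_add' := fun f g => by ext p; simp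
      map_smul' := fun c f => by ext p; simp }
    ‖(⟨convAt v, continuous_convAt v⟩ : C(Torus3, L2T →L[ℂ] ℂ))‖
    (fun f => (ContinuousMap.norm_le _ (by positivity)).2 fun p =>
      (convAt v p).le_of_opNorm_le
        (ContinuousMap.norm_coe_le_norm
          (⟨convAt v, continuous_convAt v⟩ : C(Torus3, L2T →L[ℂ] ℂ)) p) f)

/-- The interaction `(v f)(p) = (2π)^{-3/2} ∫ v (p - q) f (q) dq` on `L²(𝕋³)`. -/
def potentialOp (v : C(Torus3, ℂ)) : L2T →L[ℂ] L2T :=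
  (((2 * Real.pi) ^ (-(3 / 2) : ℝ) : ℝ) : ℂ) • (ContinuousMap.toLp 2 volume ℂ).comp (convC v)

theorem potentialOp_ae (v : C(Torus3, ℂ)) (f : L2T) :
    potentialOp v f =ᵐ[volume] fun p =>
      (((2 * Real.pi) ^ (-(3 / 2) : ℝ) : ℝ) : ℂ) * ∫ q, v (p - q) * f q := by
  refine Filter.EventuallyEq.trans (Lp.coeFn_smul _ _) ?_
  filter_upwards [ContinuousMap.coeFn_toLp (E := ℂ) (p := 2) (𝕜 := ℂ)
    (volume : Measure Torus3) (convC v f)] with p hp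
  rw [← convAt_eq]
  simp only [Pi.smul_apply, smul_eq_mul]
  congr 1

/-- The Hamiltonian with dispersion relation `e` and interaction `v`, in the momentum
representation. -/
def hamiltonian (e : C(Torus3, ℝ)) (v : C(Torus3, ℂ)) : L2T →L[ℂ] L2T :=
  mulOp e + potentialOp v

theorem hamiltonian_ae (e : C(Torus3, ℝ)) (v : C(Torus3, ℂ)) (f : L2T) :
    hamiltonian e v f =ᵐ[volume] fun p =>
      (e p : ℂ) * f p + (((2 * Real.pi) ^ (-(3 / 2) : ℝ) : ℝ) : ℂ) * ∫ q, v (p - q) * f q := by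
  refine Filter.EventuallyEq.trans (Lp.coeFn_add _ _) ?_
  filter_upwards [mulOp_ae e f, potentialOp_ae v f] with p h1 h2
  rw [Pi.add_apply]
  exact congrArg₂ (· + ·) h1 h2

/-- The Hamiltonian has an eigenvalue at the threshold `e 0` (for an `e` with minimum at `0`). -/
def HasThresholdEigenvalue (e : C(Torus3, ℝ)) (v : C(Torus3, ℂ)) : Prop :=
  Module.End.HasEigenvalue (hamiltonian e v : L2T →ₗ[ℂ] L2T) ((e 0 : ℝ) : ℂ)

/-- The Birman-Schwinger operator `G(l)`, with kernel
`(2π)^{-3/2} v (p - q) (e q - l)⁻¹`, applied to a continuous function. -/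
def birmanSchwinger (e : C(Torus3, ℝ)) (v : C(Torus3, ℂ)) (l : ℝ) (ψ : C(Torus3, ℂ)) :
    Torus3 → ℂ :=
  fun p => ∫ q, (((2 * Real.pi) ^ (-(3 / 2) : ℝ) : ℝ) : ℂ) * v (p - q) *
    (((e q - l)⁻¹ : ℝ) : ℂ) * ψ q

/-- The Hamiltonian has a virtual level at the threshold `e 0`: the number `-1` is an eigenvalue
of `G(e 0)` on `C(𝕋³)`, simple or multiple, and at least one eigenfunction `ψ` is such that
`ψ / (e - e 0)` is not in `L²(𝕋³)`. -/
def HasVirtualLevel (e : C(Torus3, ℝ)) (v : C(Torus3, ℂ)) : Prop :=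
  ∃ ψ : C(Torus3, ℂ), ψ ≠ 0 ∧ (∀ p, birmanSchwinger e v (e 0) ψ p = -ψ p) ∧
    ¬ MemLp (fun p => ψ p / ((e p - e 0 : ℝ) : ℂ)) 2 (volume : Measure Torus3)

/-- The two-particle dispersion relation `ℰ_k(p) = ε₁(p) + ε₂(k - p)`. -/
def twoParticle (ε₁ ε₂ : C(Torus3, ℝ)) (k : Torus3) : C(Torus3, ℝ) :=
  ⟨fun p => ε₁ p + ε₂ (k - p), by fun_prop⟩

/-- `ℰ_min(k)`, the minimum of `ℰ_k` over the (compact) torus. -/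
def energyMin (ε₁ ε₂ : C(Torus3, ℝ)) (k : Torus3) : ℝ := ⨅ p, twoParticle ε₁ ε₂ k p

/-- The fiber Hamiltonian `h(k)`. -/
def fiber (ε₁ ε₂ : C(Torus3, ℝ)) (v : C(Torus3, ℂ)) (k : Torus3) : L2T →L[ℂ] L2T :=
  hamiltonian (twoParticle ε₁ ε₂ k) v

/-- The discrete spectrum of a bounded self-adjoint operator: the isolated points of the spectrum
that are eigenvalues of finite multiplicity. -/
def discreteSpectrum {H : Type*} [NormedAddCommGroup H] [InnerProductSpace ℂ H]
    (A : H →L[ℂ] H) : Set ℂ :=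
  {z | (∃ r > 0, spectrum ℂ A ∩ Metric.ball z r = {z}) ∧
    Module.End.HasEigenvalue (A : H →ₗ[ℂ] H) z ∧
    FiniteDimensional ℂ (Module.End.eigenspace (A : H →ₗ[ℂ] H) z)}

/-- The essential spectrum of a bounded self-adjoint operator: the complement of the discrete
spectrum in the spectrum. -/
def essentialSpectrum {H : Type*} [NormedAddCommGroup H] [InnerProductSpace ℂ H]
    (A : H →L[ℂ] H) : Set ℂ :=
  spectrum ℂ A \ discreteSpectrum A

end

end LatticeTwoBody

/-! Put `e = ℰ_k`, let `s` be a minimiser of `e`, and let `φ = ℰ₀ - ℰ₀(0)`. The interaction is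
compact, so all spectrum below `e s` is discrete, while normalised indicators of balls shrinking to
`s` put `e s` itself in the essential spectrum. It remains to find spectrum below `e s`, that is, a
trial function whose quadratic form for `h(k) - e s` is negative.

Either alternative in the hypothesis yields an integrable `f ≠ 0` with `φ f + V f = 0`
(`IsThresholdState`). Translate `f` to be centred at `s`. The interaction has kernel `v (p - q)`, so
its form is unchanged, as it is under `f(p) ↦ conj f(-p)`. Adding the forms of the translates of `f`
and of its reflection therefore gives `∫ (e(s + p) + e(s - p) - 2 e(s) - 2 φ(p)) |f(p)|² dp`, and if
this is negative then one of the two trial functions works.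

The bracket is negative almost everywhere by conditional negative definiteness. Testing it at `0, p,
s, p + s` with weights `1, -1, -1, 1` gives `ε(p + s) + ε(p - s) ≤ 2 ε(p) + 2 ε(s) - 2 ε(0)`. The
difference of the two sides (`defect`) is again conditionally negative definite in `p`, so its zeros
form a closed subgroup of the connected torus: a null set or everything. The latter is excluded by
the mean of the defect unless `ε s = ε 0`. The bracket is minus the sum of the defects of `ε₁` at
`s` and of `ε₂` at `k - s`, and `k ≠ 0` keeps `s` and `k - s` from both vanishing
(`ae_second_difference_lt`).

For a virtual level `f = ψ / φ` need not be square integrable. It is integrable, because `s = p` in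
the inequality gives `φ(2p) ≤ 4 φ(p)`, hence `φ ≥ c ‖p‖²`, and `‖p‖⁻²` is integrable in dimension
three. Truncating `f` then produces genuine `L²` trial functions. -/

namespace LatticeTwoBody

open MeasureTheory Filter Topology

/-! ### Spectral theory of bounded self-adjoint operators. -/

section Hilbert

variable {H : Type*} [NormedAddCommGroup H] [InnerProductSpace ℂ H]

theorem sub_algebraMap_apply (A : H →L[ℂ] H) (t : ℂ) (x : H) :
    (A - algebraMap ℂ (H →L[ℂ] H) t) x = A x - t • x := by
  simp [Algebra.algebraMap_eq_smul_one]

/-- Approximate eigenvectors of `A` at `t` have convergent subsequences. -/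
def HasCompactApproxEigenvectors (A : H →L[ℂ] H) (t : ℝ) : Prop :=
  ∀ x : ℕ → H, (∀ n, ‖x n‖ ≤ 1) → Tendsto (fun n => A (x n) - (t : ℂ) • x n) atTop (𝓝 0) →
    ∃ y, ∃ φ : ℕ → ℕ, StrictMono φ ∧ Tendsto (x ∘ φ) atTop (𝓝 y)

/-- Exact eigenvectors are approximate ones, so the closed unit ball of the eigenspace is compact
and Riesz's theorem applies. -/
theorem HasCompactApproxEigenvectors.finiteDimensional {A : H →L[ℂ] H} {t : ℝ}
    (h : HasCompactApproxEigenvectors A t) :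
    FiniteDimensional ℂ (Module.End.eigenspace (A : H →ₗ[ℂ] H) (t : ℂ)) := by
  refine FiniteDimensional.of_isCompact_closedBall₀ ℂ one_pos ?_
  refine IsSeqCompact.isCompact fun x hx => ?_
  have hx' : ∀ n, ‖(x n : H)‖ ≤ 1 := fun n => by simpa using hx n
  have hev : ∀ n, A (x n : H) - (t : ℂ) • (x n : H) = 0 := fun n => by
    rw [sub_eq_zero]; exact Module.End.mem_eigenspace_iff.1 (x n).2
  obtain ⟨y, φ, hφ, hy⟩ := h (fun n => (x n : H)) hx'
    (by simp only [hev]; exact tendsto_const_nhds)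
  have hyE : y ∈ Module.End.eigenspace (A : H →ₗ[ℂ] H) (t : ℂ) := by
    rw [Module.End.mem_eigenspace_iff, ← sub_eq_zero]
    have h1 : Tendsto (fun n => A (x (φ n) : H) - (t : ℂ) • (x (φ n) : H)) atTop
        (𝓝 (A y - (t : ℂ) • y)) :=
      ((A.continuous.tendsto y).comp hy).sub (hy.const_smul (t : ℂ))
    simp only [hev] at h1
    exact (tendsto_nhds_unique h1 tendsto_const_nhds)
  refine ⟨⟨y, hyE⟩, ?_, φ, hφ, ?_⟩
  · have := le_of_tendsto' hy.norm (fun n => hx' (φ n))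
    simpa using this
  · rw [tendsto_subtype_rng]
    exact hy

/-- Otherwise unit approximate eigenvectors orthogonal to the eigenspace would subconverge to a unit
eigenvector that is still orthogonal to it. -/
theorem HasCompactApproxEigenvectors.exists_bound {A : H →L[ℂ] H} {t : ℝ}
    (h : HasCompactApproxEigenvectors A t) :
    ∃ c > 0, ∀ x ∈ (Module.End.eigenspace (A : H →ₗ[ℂ] H) (t : ℂ))ᗮ,
      c * ‖x‖ ≤ ‖A x - (t : ℂ) • x‖ := by
  by_contra! hcon
  have h1 : ∀ n : ℕ, ∃ x ∈ (Module.End.eigenspace (A : H →ₗ[ℂ] H) (t : ℂ))ᗮ, ‖x‖ = 1 ∧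
      ‖A x - (t : ℂ) • x‖ ≤ 1 / ((n : ℝ) + 1) := by
    intro n
    obtain ⟨x, hxE, hx⟩ := hcon (1 / ((n : ℝ) + 1)) (by positivity)
    have hx0 : x ≠ 0 := by rintro rfl; simp at hx
    have hn : 0 < ‖x‖ := norm_pos_iff.2 hx0
    refine ⟨((‖x‖⁻¹ : ℝ) : ℂ) • x, Submodule.smul_mem _ _ hxE, ?_, ?_⟩
    · rw [norm_smul]; simp [hn.ne']
    · rw [map_smul, smul_comm, ← smul_sub, norm_smul]
      simp only [Complex.norm_real, norm_inv, norm_norm]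
      rw [inv_mul_le_iff₀ hn, mul_comm]
      exact hx.le
  choose x hxE hx1 hx2 using h1
  have hlim : Tendsto (fun n => A (x n) - (t : ℂ) • x n) atTop (𝓝 0) :=
    squeeze_zero_norm hx2 tendsto_one_div_add_atTop_nhds_zero_nat
  obtain ⟨y, φ, hφ, hy⟩ := h x (fun n => (hx1 n).le) hlim
  have hy1 : ‖y‖ = 1 := tendsto_nhds_unique hy.norm (by simp [hx1])
  have hyE : y ∈ Module.End.eigenspace (A : H →ₗ[ℂ] H) (t : ℂ) := by
    rw [Module.End.mem_eigenspace_iff, ← sub_eq_zero]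
    exact tendsto_nhds_unique (((A.continuous.tendsto y).comp hy).sub (hy.const_smul (t : ℂ)))
      (hlim.comp hφ.tendsto_atTop)
  have hyE' : y ∈ (Module.End.eigenspace (A : H →ₗ[ℂ] H) (t : ℂ))ᗮ :=
    (Submodule.isClosed_orthogonal _).mem_of_tendsto hy (Eventually.of_forall fun n => hxE _)
  have : y = 0 := by
    have := Submodule.inner_right_of_mem_orthogonal hyE hyE'
    simpa using this
  simp [this] at hy1

variable [CompleteSpace H]

/-- The lower bound gives injectivity and closed range; the orthogonal complement of the range is
the kernel of `B† = B`, so the range is also dense. -/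
theorem isUnit_of_isSelfAdjoint_of_bound {B : H →L[ℂ] H} (hB : IsSelfAdjoint B) {c : ℝ}
    (hc : 0 < c) (h : ∀ x, c * ‖x‖ ≤ ‖B x‖) : IsUnit B := by
  rw [ContinuousLinearMap.isUnit_iff_bijective,
    ContinuousLinearMap.bijective_iff_dense_range_and_antilipschitz]
  have hanti : AntilipschitzWith (c.toNNReal)⁻¹ B := by
    refine B.antilipschitz_of_bound fun x => ?_
    rw [NNReal.coe_inv, inv_mul_eq_div, Real.coe_toNNReal c hc.le, le_div_iff₀ hc, mul_comm]
    exact h x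
  refine ⟨?_, ⟨_, hanti⟩⟩
  rw [Submodule.topologicalClosure_eq_top_iff, B.orthogonal_range,
    ContinuousLinearMap.isSelfAdjoint_iff'.1 hB]
  exact LinearMap.ker_eq_bot.2 hanti.injective

theorem isSelfAdjoint_sub_real {A : H →L[ℂ] H} (hA : IsSelfAdjoint A) (t : ℝ) :
    IsSelfAdjoint (A - algebraMap ℂ (H →L[ℂ] H) t) := by
  refine hA.sub ?_
  rw [isSelfAdjoint_iff, ← algebraMap_star_comm]
  simp

theorem not_mem_spectrum_of_bound {A : H →L[ℂ] H} (hA : IsSelfAdjoint A) {t c : ℝ} (hc : 0 < c)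
    (h : ∀ x, c * ‖x‖ ≤ ‖A x - (t : ℂ) • x‖) : (t : ℂ) ∉ spectrum ℂ A := by
  rw [spectrum.notMem_iff, IsUnit.sub_iff]
  exact isUnit_of_isSelfAdjoint_of_bound (isSelfAdjoint_sub_real hA t) hc
    fun x => by rw [sub_algebraMap_apply]; exact h x

theorem mem_discreteSpectrum_of_hasCompactApproxEigenvectors {A : H →L[ℂ] H}
    (hA : IsSelfAdjoint A) {t : ℝ} (h : HasCompactApproxEigenvectors A t)
    (ht : (t : ℂ) ∈ spectrum ℂ A) : (t : ℂ) ∈ discreteSpectrum A := by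
  obtain ⟨c, hc, hbound⟩ := h.exists_bound
  have hfin := h.finiteDimensional
  set E := Module.End.eigenspace (A : H →ₗ[ℂ] H) (t : ℂ) with hE
  have hsymm := hA.isSymmetric
  refine ⟨⟨c, hc, ?_⟩, ?_, hfin⟩
  · refine Set.eq_singleton_iff_unique_mem.2 ⟨⟨ht, Metric.mem_ball_self hc⟩, ?_⟩
    rintro w ⟨hw, hwc⟩
    by_contra hne
    have hwre := hA.mem_spectrum_eq_re hw
    obtain ⟨s, rfl⟩ : ∃ s : ℝ, w = s := ⟨w.re, hwre⟩
    have hst : |s - t| < c := by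
      rw [Metric.mem_ball, dist_eq_norm, ← Complex.ofReal_sub, Complex.norm_real] at hwc
      exact hwc
    have hst0 : 0 < |s - t| := abs_pos.2 (sub_ne_zero.2 fun h => hne (by rw [h]))
    -- `A - s` is multiplication by `t - s` on the eigenspace and is bounded below by `c - |s - t|`
    -- on its orthogonal complement. Both subspaces are invariant, so the smaller constant works on
    -- the sum.
    refine not_mem_spectrum_of_bound hA (c := min |s - t| (c - |s - t|))
      (lt_min hst0 (by linarith)) (fun x => ?_) hw
    set m := min |s - t| (c - |s - t|) with hm
    have hm0 : 0 < m := lt_min hst0 (by linarith)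
    obtain ⟨a, ha, b, hb, rfl⟩ := E.exists_add_mem_mem_orthogonal x
    have hAa : A a = (t : ℂ) • a := Module.End.mem_eigenspace_iff.1 ha
    have hAb : A b ∈ Eᗮ := hsymm.invariant_orthogonalComplement_eigenspace _ b hb
    have e1 : A (a + b) - (s : ℂ) • (a + b) = ((t - s : ℝ) : ℂ) • a + (A b - (s : ℂ) • b) := by
      rw [map_add, hAa]; push_cast; module
    have hb' : A b - (s : ℂ) • b ∈ Eᗮ := Submodule.sub_mem _ hAb (Submodule.smul_mem _ _ hb)
    have o1 : inner ℂ a b = 0 := Submodule.inner_right_of_mem_orthogonal ha hb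
    have o2 : inner ℂ (((t - s : ℝ) : ℂ) • a) (A b - (s : ℂ) • b) = 0 :=
      Submodule.inner_right_of_mem_orthogonal (Submodule.smul_mem _ _ ha) hb'
    have n1 := norm_add_sq_eq_norm_sq_add_norm_sq_of_inner_eq_zero _ _ o1
    have n2 := norm_add_sq_eq_norm_sq_add_norm_sq_of_inner_eq_zero _ _ o2
    have n3 : m * ‖a‖ ≤ ‖((t - s : ℝ) : ℂ) • a‖ := by
      rw [norm_smul, Complex.norm_real, Real.norm_eq_abs, abs_sub_comm]
      exact mul_le_mul_of_nonneg_right (min_le_left _ _) (norm_nonneg _)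
    have n4 : m * ‖b‖ ≤ ‖A b - (s : ℂ) • b‖ := by
      have e2 : A b - (s : ℂ) • b = (A b - (t : ℂ) • b) - ((s - t : ℝ) : ℂ) • b := by
        push_cast; module
      have h3 : ‖((s - t : ℝ) : ℂ) • b‖ = |s - t| * ‖b‖ := by
        rw [norm_smul, Complex.norm_real, Real.norm_eq_abs]
      have h4 := norm_sub_norm_le (A b - (t : ℂ) • b) (((s - t : ℝ) : ℂ) • b)
      rw [← e2, h3] at h4
      have h5 := hbound b hb
      have h6 : m * ‖b‖ ≤ (c - |s - t|) * ‖b‖ :=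
        mul_le_mul_of_nonneg_right (min_le_right _ _) (norm_nonneg _)
      linarith
    rw [e1]
    refine le_of_sq_le_sq ?_ (norm_nonneg _)
    have q1 := mul_self_le_mul_self (by positivity) n3
    have q2 := mul_self_le_mul_self (by positivity) n4
    calc (m * ‖a + b‖) ^ 2 = m ^ 2 * (‖a + b‖ * ‖a + b‖) := by ring
      _ = m * ‖a‖ * (m * ‖a‖) + m * ‖b‖ * (m * ‖b‖) := by rw [n1]; ring
      _ ≤ ‖((t - s : ℝ) : ℂ) • a + (A b - (s : ℂ) • b)‖ ^ 2 := by
        rw [pow_two, n2]; exact add_le_add q1 q2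
  · rw [Module.End.hasEigenvalue_iff]
    intro hbot
    refine not_mem_spectrum_of_bound hA hc (fun x => hbound x ?_) ht
    rw [hE, hbot]; simp

/-- Weyl's criterion. -/
theorem mem_essentialSpectrum_of_singular_sequence {A : H →L[ℂ] H} (hA : IsSelfAdjoint A) {t : ℝ}
    (x : ℕ → H) (hx : ∀ n, ‖x n‖ = 1)
    (hlim : Tendsto (fun n => A (x n) - (t : ℂ) • x n) atTop (𝓝 0))
    (hsub : ∀ y, ∀ φ : ℕ → ℕ, StrictMono φ → ¬ Tendsto (x ∘ φ) atTop (𝓝 y)) :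
    (t : ℂ) ∈ essentialSpectrum A := by
  set B := A - algebraMap ℂ (H →L[ℂ] H) (t : ℂ) with hB
  have hBsa : IsSelfAdjoint B := isSelfAdjoint_sub_real hA t
  have hBx : ∀ x, B x = A x - (t : ℂ) • x := sub_algebraMap_apply A _
  refine ⟨fun hres => ?_, ?_⟩
  · have hu : IsUnit B := by
      have := hres
      change IsUnit _ at this
      rwa [IsUnit.sub_iff] at this
    obtain ⟨u, hu⟩ := hu
    have hinv : ∀ y, (↑u⁻¹ : H →L[ℂ] H) (B y) = y := fun y => by
      rw [← hu]; exact DFunLike.congr_fun u.inv_mul y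
    have h1 : Tendsto (fun n => (↑u⁻¹ : H →L[ℂ] H) (A (x n) - (t : ℂ) • x n)) atTop (𝓝 0) := by
      rw [← map_zero (↑u⁻¹ : H →L[ℂ] H)]
      exact ((↑u⁻¹ : H →L[ℂ] H).continuous.tendsto 0).comp hlim
    simp only [← hBx, hinv] at h1
    have h2 := h1.norm
    simp only [hx, norm_zero] at h2
    exact one_ne_zero (tendsto_nhds_unique tendsto_const_nhds h2)
  · rintro ⟨⟨r, hr, hiso⟩, -, hfin⟩
    have hspec : ∀ s ∈ spectrum ℝ B, s = 0 ∨ r ≤ |s| := by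
      intro s hs
      by_contra! hcon
      have h1 : ((s + t : ℝ) : ℂ) ∈ spectrum ℂ A := by
        have h2 : (s : ℂ) ∈ spectrum ℂ B := by
          have := (spectrum.algebraMap_mem_iff ℂ (r := s) (a := B)).2 hs
          simpa using this
        have h3 := spectrum.add_mem_add_iff (R := ℂ) (a := B) (r := (s : ℂ)) (s := (t : ℂ))
        rw [hB, add_sub_cancel] at h3
        push_cast
        exact h3.2 h2
      have h4 : ((s + t : ℝ) : ℂ) ∈ ({(t : ℂ)} : Set ℂ) := by
        rw [← hiso]
        refine ⟨h1, ?_⟩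
        rw [Metric.mem_ball, dist_eq_norm, ← Complex.ofReal_sub, Complex.norm_real,
          add_sub_cancel_right]
        exact hcon.2
      rw [Set.mem_singleton_iff, Complex.ofReal_inj] at h4
      exact hcon.1 (by linarith)
    -- With the convention `0⁻¹ = 0`, inversion is continuous on the spectrum because `0` is at most
    -- an isolated point of it. The functional calculus then gives a bounded `G` with `B G B = B`.
    have hcont : ContinuousOn (fun s : ℝ => s⁻¹) (spectrum ℝ B) := by
      intro s hs
      rcases eq_or_ne s 0 with rfl | h0
      · refine ContinuousWithinAt.congr_of_eventuallyEq (f := fun _ => 0)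
          continuousWithinAt_const ?_ (by simp)
        filter_upwards [self_mem_nhdsWithin,
          mem_nhdsWithin_of_mem_nhds (Metric.ball_mem_nhds (0 : ℝ) hr)] with a ha hb
        rcases hspec a ha with h | h
        · simp [h]
        · rw [mem_ball_zero_iff, Real.norm_eq_abs] at hb
          linarith
      · exact (continuousAt_inv₀ h0).continuousWithinAt
    set G := cfc (fun s : ℝ => s⁻¹) B with hG
    have hid : cfc (fun s : ℝ => s) B = B := cfc_id' ℝ B
    have hBGB : B * (G * B) = B := by
      have h1 : G * B = cfc (fun s : ℝ => s⁻¹ * s) B := by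
        rw [cfc_mul (fun s : ℝ => s⁻¹) (fun s => s) B hcont continuousOn_id, ← hG, hid]
      have h2 : ContinuousOn (fun s : ℝ => s⁻¹ * s) (spectrum ℝ B) := hcont.mul continuousOn_id
      have h3 : B * (G * B) = cfc (fun s : ℝ => s * (s⁻¹ * s)) B := by
        rw [cfc_mul (fun s : ℝ => s) (fun s => s⁻¹ * s) B continuousOn_id h2, h1, hid]
      have h4 : (fun s : ℝ => s * (s⁻¹ * s)) = fun s => s := by
        ext s
        rcases eq_or_ne s 0 with rfl | h0
        · simp
        · field_simp
      rw [h3, h4, hid]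
    have hker : ∀ y, y - G (B y) ∈ Module.End.eigenspace (A : H →ₗ[ℂ] H) (t : ℂ) := by
      intro y
      rw [Module.End.mem_eigenspace_iff, ← sub_eq_zero]
      change A (y - G (B y)) - _ = 0
      rw [← hBx, map_sub, sub_eq_zero]
      exact (DFunLike.congr_fun hBGB y).symm
    have hsmall : Tendsto (fun n => G (B (x n))) atTop (𝓝 0) := by
      simp only [hBx]
      rw [← map_zero G]
      exact (G.continuous.tendsto 0).comp hlim
    -- Since `G (B (x n)) → 0`, the sequence is asymptotic to a bounded one in the
    -- finite-dimensional eigenspace, which forces the forbidden convergent subsequence.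
    let e : ℕ → Module.End.eigenspace (A : H →ₗ[ℂ] H) (t : ℂ) := fun n => ⟨_, hker (x n)⟩
    have hbd : ∀ᶠ n in atTop, e n ∈ Metric.closedBall 0 2 := by
      filter_upwards [hsmall.norm.eventually (gt_mem_nhds (by simp : ‖(0 : H)‖ < 1))] with n hn
      have : ‖x n - G (B (x n))‖ ≤ 2 := by
        refine (norm_sub_le _ _).trans ?_
        rw [hx]; linarith
      simpa [e] using this
    have : ProperSpace (Module.End.eigenspace (A : H →ₗ[ℂ] H) (t : ℂ)) :=
      FiniteDimensional.proper ℂ _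
    obtain ⟨y, -, φ, hφ, hy⟩ := (isCompact_closedBall (0 : Module.End.eigenspace
      (A : H →ₗ[ℂ] H) (t : ℂ)) 2).tendsto_subseq' hbd.frequently
    refine hsub (y : H) φ hφ ?_
    have h5 : Tendsto (fun n => ((e (φ n) : H))) atTop (𝓝 (y : H)) :=
      (continuous_subtype_val.tendsto y).comp hy
    have h6 := h5.add (hsmall.comp hφ.tendsto_atTop)
    simpa [e, Function.comp_def] using h6

/-- Variational principle: without spectrum below `t`, the operator `A - t` would be positive. -/
theorem exists_mem_spectrum_lt {A : H →L[ℂ] H} (hA : IsSelfAdjoint A) {t : ℝ} {x : H}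
    (hx : (inner ℂ x (A x)).re < t * ‖x‖ ^ 2) : ∃ s : ℝ, s < t ∧ (s : ℂ) ∈ spectrum ℂ A := by
  by_contra! hcon
  set B := A - algebraMap ℂ (H →L[ℂ] H) (t : ℂ) with hB
  have hBsa : IsSelfAdjoint B := isSelfAdjoint_sub_real hA t
  have hpos : 0 ≤ B := by
    rw [StarOrderedRing.nonneg_iff_spectrum_nonneg (R := ℝ) B hBsa]
    intro s hs
    by_contra! hneg
    refine hcon (s + t) (by linarith) ?_
    have h2 : (s : ℂ) ∈ spectrum ℂ B := by
      have := (spectrum.algebraMap_mem_iff ℂ (r := s) (a := B)).2 hs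
      simpa using this
    have h3 := spectrum.add_mem_add_iff (R := ℂ) (a := B) (r := (s : ℂ)) (s := (t : ℂ))
    rw [hB, add_sub_cancel] at h3
    push_cast
    exact h3.2 h2
  have h4 := ((ContinuousLinearMap.nonneg_iff_isPositive B).1 hpos).re_inner_nonneg_right x
  rw [sub_algebraMap_apply, inner_sub_right, inner_smul_right, inner_self_eq_norm_sq_to_K] at h4
  have h5 : ((t : ℂ) * ((‖x‖ : ℝ) : ℂ) ^ 2).re = t * ‖x‖ ^ 2 := by
    rw [← Complex.ofReal_pow, ← Complex.ofReal_mul, Complex.ofReal_re]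
  simp only [map_sub, RCLike.re_to_complex] at h4
  erw [h5] at h4
  linarith

end Hilbert

/-! ### Self-adjointness of the Hamiltonian and compactness of the interaction. -/

section Operators

theorem isSelfAdjoint_mulOp (e : C(Torus3, ℝ)) : IsSelfAdjoint (mulOp e) := by
  rw [ContinuousLinearMap.isSelfAdjoint_iff_isSymmetric]
  intro f g
  change inner ℂ (mulOp e f) g = inner ℂ f (mulOp e g)
  rw [L2.inner_def, L2.inner_def]
  refine integral_congr_ae ?_
  filter_upwards [mulOp_ae e f, mulOp_ae e g] with p h1 h2
  rw [h1, h2]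
  simp only [RCLike.inner_apply, map_mul, Complex.conj_ofReal]
  ring

theorem mulOp_mulOp (e₁ e₂ : C(Torus3, ℝ)) (f : L2T) :
    mulOp e₁ (mulOp e₂ f) = mulOp (e₁ * e₂) f := by
  refine Lp.ext ?_
  filter_upwards [mulOp_ae e₁ (mulOp e₂ f), mulOp_ae e₂ f, mulOp_ae (e₁ * e₂) f] with p h1 h2 h3
  rw [h1, h2, h3, ContinuousMap.mul_apply]
  push_cast
  ring

theorem mulOp_const (t : ℝ) (f : L2T) : mulOp (ContinuousMap.const _ t) f = (t : ℂ) • f := by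
  refine Lp.ext ?_
  filter_upwards [mulOp_ae (ContinuousMap.const _ t) f, Lp.coeFn_smul (t : ℂ) f] with p h1 h2
  rw [h1, h2]
  rfl

theorem mulOp_sub (e₁ e₂ : C(Torus3, ℝ)) (f : L2T) :
    mulOp (e₁ - e₂) f = mulOp e₁ f - mulOp e₂ f := by
  refine Lp.ext ?_
  filter_upwards [mulOp_ae (e₁ - e₂) f, mulOp_ae e₁ f, mulOp_ae e₂ f,
    Lp.coeFn_sub (mulOp e₁ f) (mulOp e₂ f)] with p h1 h2 h3 h4
  rw [h1, h4, Pi.sub_apply, h2, h3, ContinuousMap.sub_apply]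
  push_cast
  ring

theorem exists_mulOp_leftInverse (e : C(Torus3, ℝ)) {t : ℝ} (ht : ∀ p, t < e p) :
    ∃ R : L2T →L[ℂ] L2T, ∀ f, R (mulOp e f - (t : ℂ) • f) = f := by
  refine ⟨mulOp ⟨fun p => (e p - t)⁻¹, ?_⟩, fun f => ?_⟩
  · exact Continuous.inv₀ (by fun_prop) fun p => (sub_pos.2 (ht p)).ne'
  · rw [← mulOp_const, ← mulOp_sub, mulOp_mulOp]
    convert! mulOp_const 1 f using 1
    · congr 2
      ext p
      exact inv_mul_cancel₀ (sub_pos.2 (ht p)).ne'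
    · simp

/-- The coupling constant `(2π)^{-3/2}`. -/
noncomputable def coupling : ℝ := (2 * Real.pi) ^ (-(3 / 2) : ℝ)

theorem coupling_pos : 0 < coupling := Real.rpow_pos_of_pos Real.two_pi_pos _

/-- `∫ conj f(p) v(p - q) f(q) dq dp`. -/
noncomputable def convForm (v : C(Torus3, ℂ)) (f g : Torus3 → ℂ) : ℂ :=
  ∫ p, ∫ q, (starRingEnd ℂ) (f p) * v (p - q) * g q

theorem integrable_convKernel (v : C(Torus3, ℂ)) {f g : Torus3 → ℂ} (hf : Integrable f)
    (hg : Integrable g) :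
    Integrable (fun z : Torus3 × Torus3 => (starRingEnd ℂ) (f z.1) * v (z.1 - z.2) * g z.2)
      (volume.prod volume) := by
  have h1 : Integrable (fun z : Torus3 × Torus3 => (starRingEnd ℂ) (f z.1) * g z.2)
      (volume.prod volume) := by
    refine Integrable.mul_prod (f := fun p => (starRingEnd ℂ) (f p)) ?_ hg
    exact (LinearIsometryEquiv.integrable_comp_iff Complex.conjLIE).2 hf
  have h2 := h1.bdd_mul (f := fun z : Torus3 × Torus3 => v (z.1 - z.2)) (c := ‖v‖)
    (by fun_prop) (Eventually.of_forall fun z => v.norm_coe_le_norm _)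
  refine h2.congr (Eventually.of_forall fun z => ?_)
  ring

theorem convForm_symm (v : C(Torus3, ℂ)) (hv : ∀ p, v p = (starRingEnd ℂ) (v (-p)))
    {f g : Torus3 → ℂ} (hf : Integrable f) (hg : Integrable g) :
    (starRingEnd ℂ) (convForm v f g) = convForm v g f := by
  rw [convForm, integral_integral_swap (integrable_convKernel v hf hg), convForm, ← integral_conj]
  congr 1
  ext p
  rw [← integral_conj]
  congr 1
  ext q
  have : v (p - q) = (starRingEnd ℂ) (v (q - p)) := by rw [hv (p - q), neg_sub]
  rw [this]
  simp only [map_mul, Complex.conj_conj]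
  ring

theorem inner_potentialOp (v : C(Torus3, ℂ)) (f g : L2T) :
    inner ℂ f (potentialOp v g) = coupling * convForm v f g := by
  rw [L2.inner_def, convForm, ← integral_const_mul]
  refine integral_congr_ae ?_
  filter_upwards [potentialOp_ae v g] with p hp
  rw [hp, RCLike.inner_apply]
  simp only [mul_assoc]
  rw [integral_const_mul, coupling]
  ring

theorem integrable_of_L2T (f : L2T) : Integrable (f : Torus3 → ℂ) :=
  (Lp.memLp f).integrable (by norm_num)

theorem isSelfAdjoint_potentialOp {v : C(Torus3, ℂ)} (hv : ∀ p, v p = (starRingEnd ℂ) (v (-p))) :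
    IsSelfAdjoint (potentialOp v) := by
  rw [ContinuousLinearMap.isSelfAdjoint_iff_isSymmetric]
  intro f g
  change inner ℂ (potentialOp v f) g = inner ℂ f (potentialOp v g)
  rw [← inner_conj_symm, inner_potentialOp, inner_potentialOp, map_mul, Complex.conj_ofReal,
    convForm_symm v hv (integrable_of_L2T g) (integrable_of_L2T f)]

theorem isSelfAdjoint_hamiltonian (e : C(Torus3, ℝ)) {v : C(Torus3, ℂ)}
    (hv : ∀ p, v p = (starRingEnd ℂ) (v (-p))) : IsSelfAdjoint (hamiltonian e v) :=
  (isSelfAdjoint_mulOp e).add (isSelfAdjoint_potentialOp hv)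

theorem convC_apply (v : C(Torus3, ℂ)) (f : L2T) (p : Torus3) : convC v f p = convAt v p f := rfl

/-- Arzelà–Ascoli: the functionals `convAt v p` depend on `p` continuously in operator norm, so the
image of the unit ball is equicontinuous. -/
theorem isCompactOperator_convC (v : C(Torus3, ℂ)) : IsCompactOperator (convC v) := by
  refine (isCompactOperator_iff_isCompact_closure_image_closedBall (𝕜₁ := ℂ) (𝕜₂ := ℂ)
    (convC v : L2T →ₗ[ℂ] C(Torus3, ℂ)) one_pos).2 ?_
  set S := (convC v : L2T →ₗ[ℂ] C(Torus3, ℂ)) '' Metric.closedBall 0 1 with hS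
  let Φ := ContinuousMap.equivBoundedOfCompact Torus3 ℂ
  have hiso : Isometry Φ := ContinuousMap.isometryEquivBoundedOfCompact Torus3 ℂ |>.isometry
  have h1 : IsCompact (closure (Φ '' S)) := by
    refine BoundedContinuousFunction.arzela_ascoli (Metric.closedBall 0 ‖convC v‖)
      (isCompact_closedBall _ _) _ ?_ ?_
    · rintro _ p ⟨_, ⟨f, hf, rfl⟩, rfl⟩
      rw [mem_closedBall_zero_iff] at hf ⊢
      refine ((convC v f).norm_coe_le_norm p).trans (((convC v).le_opNorm f).trans ?_)
      exact mul_le_of_le_one_right (norm_nonneg _) hf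
    · intro p
      rw [Metric.equicontinuousAt_iff_right]
      intro ε hε
      filter_upwards [(continuous_convAt v).continuousAt (x := p) (Metric.ball_mem_nhds _ hε)]
        with q hq
      rintro ⟨_, ⟨_, ⟨f, hf, rfl⟩, rfl⟩⟩
      rw [mem_closedBall_zero_iff] at hf
      change dist (convAt v p f) (convAt v q f) < ε
      rw [dist_comm, dist_eq_norm, ← sub_apply]
      refine ((convAt v q - convAt v p).le_opNorm f).trans_lt ?_
      refine (mul_le_of_le_one_right (norm_nonneg _) hf).trans_lt ?_
      simpa [dist_eq_norm] using hq
  have h2 : IsCompact (Φ ⁻¹' closure (Φ '' S)) :=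
    (ContinuousMap.isometryEquivBoundedOfCompact Torus3 ℂ).toHomeomorph.isCompact_preimage.2 h1
  refine h2.of_isClosed_subset isClosed_closure (closure_minimal ?_ ?_)
  · exact fun f hf => subset_closure ⟨f, hf, rfl⟩
  · exact isClosed_closure.preimage hiso.continuous

theorem isCompactOperator_potentialOp (v : C(Torus3, ℂ)) : IsCompactOperator (potentialOp v) := by
  have := ((isCompactOperator_convC v).clm_comp
    (ContinuousMap.toLp (E := ℂ) 2 (volume : Measure Torus3) ℂ)).smul
      (((2 * Real.pi) ^ (-(3 / 2) : ℝ) : ℝ) : ℂ)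
  exact this

/-- With `R` inverting `e - t`, one has `x = R ((h - t) x - V x)`, and `V x` subconverges by
compactness. -/
theorem hasCompactApproxEigenvectors_hamiltonian (e : C(Torus3, ℝ)) (v : C(Torus3, ℂ)) {t : ℝ}
    (ht : ∀ p, t < e p) : HasCompactApproxEigenvectors (hamiltonian e v) t := by
  intro x hx hlim
  obtain ⟨R, hR⟩ := exists_mulOp_leftInverse e ht
  obtain ⟨K, hK, hKx⟩ := (isCompactOperator_potentialOp v).image_closedBall_subset_compact
    (f := (potentialOp v : L2T →ₗ[ℂ] L2T)) 1
  obtain ⟨y, -, φ, hφ, hy⟩ := hK.tendsto_subseq (x := fun n => potentialOp v (x n))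
    fun n => hKx ⟨x n, by simpa using hx n, rfl⟩
  refine ⟨R (0 - y), φ, hφ, ?_⟩
  have h1 := (hlim.comp hφ.tendsto_atTop).sub hy
  have h2 := (R.continuous.tendsto _).comp h1
  refine h2.congr fun n => ?_
  have h3 : hamiltonian e v (x (φ n)) = mulOp e (x (φ n)) + potentialOp v (x (φ n)) := rfl
  simp only [Function.comp_apply, h3]
  rw [← hR (x (φ n))]
  congr 1
  rw [hR]
  abel

end Operators

/-! ### Values of the dispersion relation in the essential spectrum. -/

section Weyl

theorem exists_integral_norm_le :
    ∃ C : ℝ, ∀ f : L2T, ∫ p, ‖f p‖ ≤ C * ‖f‖ := by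
  refine ⟨((volume (Set.univ : Set Torus3)) ^ (1 / (1 : ENNReal).toReal -
    1 / (2 : ENNReal).toReal)).toReal, fun f => ?_⟩
  have h1 := eLpNorm_le_eLpNorm_mul_rpow_measure_univ (μ := (volume : Measure Torus3))
    (p := 1) (q := 2) (by norm_num) (Lp.memLp f).1
  rw [integral_norm_eq_lintegral_enorm (Lp.memLp f).1, ← eLpNorm_one_eq_lintegral_enorm,
    Lp.norm_def, ← ENNReal.toReal_mul]
  refine ENNReal.toReal_mono (ENNReal.mul_ne_top ?_ (Lp.memLp f).2.ne)
    (h1.trans_eq (mul_comm _ _))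
  exact ENNReal.rpow_ne_top_of_nonneg (by norm_num) (measure_ne_top _ _)

theorem exists_norm_potentialOp_le (v : C(Torus3, ℂ)) :
    ∃ C : ℝ, ∀ f : L2T, ‖potentialOp v f‖ ≤ C * ∫ p, ‖f p‖ := by
  let T := ContinuousMap.toLp (E := ℂ) 2 (volume : Measure Torus3) ℂ
  refine ⟨coupling * ‖T‖ * ‖v‖, fun f => ?_⟩
  have hI : 0 ≤ ∫ p, ‖f p‖ := integral_nonneg fun _ => norm_nonneg _
  have h1 : ‖convC v f‖ ≤ ‖v‖ * ∫ p, ‖f p‖ := by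
    refine (ContinuousMap.norm_le _ (by positivity)).2 fun p => ?_
    rw [convC_apply, convAt_eq, ← integral_const_mul]
    refine norm_integral_le_of_norm_le ((integrable_of_L2T f).norm.const_mul _)
      (Eventually.of_forall fun q => ?_)
    rw [norm_mul]
    gcongr
    exact v.norm_coe_le_norm _
  have h2 : potentialOp v f = (coupling : ℂ) • T (convC v f) := rfl
  rw [h2, norm_smul, Complex.norm_real, Real.norm_of_nonneg coupling_pos.le, mul_assoc, mul_assoc]
  gcongr
  · exact coupling_pos.le
  · exact (T.le_opNorm _).trans (by gcongr)

/-- The singular sequence consists of `L²`-normalised indicators of balls shrinking to `s`. Their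
`L¹` norms are the square roots of the volumes and tend to `0`. The interaction is controlled by the
`L¹` norm, so it disappears in the limit. -/
theorem mem_essentialSpectrum_hamiltonian (e : C(Torus3, ℝ)) {v : C(Torus3, ℂ)}
    (hv : ∀ p, v p = (starRingEnd ℂ) (v (-p))) (s : Torus3) :
    ((e s : ℝ) : ℂ) ∈ essentialSpectrum (hamiltonian e v) := by
  let B : ℕ → Set Torus3 := fun n => Metric.closedBall s (1 / ((n : ℝ) + 1))
  have hBm : ∀ n, MeasurableSet (B n) := fun n => measurableSet_closedBall
  have hBtop : ∀ n, volume (B n) ≠ ⊤ := fun n => measure_ne_top _ _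
  let V : ℕ → ℝ := fun n => volume.real (B n)
  have hV : ∀ n, 0 < V n := fun n =>
    ENNReal.toReal_pos (Metric.measure_closedBall_pos volume s (by positivity)).ne' (hBtop n)
  let x : ℕ → L2T := fun n =>
    indicatorConstLp 2 (hBm n) (hBtop n) (((V n) ^ (-(1 / 2) : ℝ) : ℝ) : ℂ)
  have hxae : ∀ n, x n =ᵐ[volume] (B n).indicator fun _ => (((V n) ^ (-(1 / 2) : ℝ) : ℝ) : ℂ) :=
    fun n => indicatorConstLp_coeFn
  have hc : ∀ n, ‖(((V n) ^ (-(1 / 2) : ℝ) : ℝ) : ℂ)‖ = (V n) ^ (-(1 / 2) : ℝ) := fun n => by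
    rw [Complex.norm_real, Real.norm_of_nonneg (Real.rpow_nonneg (hV n).le _)]
  have hx1 : ∀ n, ‖x n‖ = 1 := by
    intro n
    rw [norm_indicatorConstLp (by norm_num) (by norm_num), hc]
    change (V n) ^ (-(1 / 2) : ℝ) * (V n) ^ _ = 1
    rw [← Real.rpow_add (hV n)]
    norm_num
  have hint : ∀ n, ∫ p, ‖x n p‖ = (V n) ^ (1 / 2 : ℝ) := by
    intro n
    have h1 : ∫ p, ‖x n p‖ = ∫ p, (B n).indicator (fun _ => (V n) ^ (-(1 / 2) : ℝ)) p := by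
      refine integral_congr_ae ?_
      filter_upwards [hxae n] with p hp
      rw [hp, norm_indicator_eq_indicator_norm]
      simp only [hc]
    rw [h1, integral_indicator_const _ (hBm n), smul_eq_mul]
    change V n * _ = _
    nth_rewrite 1 [← Real.rpow_one (V n)]
    rw [← Real.rpow_add (hV n)]
    norm_num
  have hVlim : Tendsto V atTop (𝓝 0) := by
    have h1 : Tendsto (fun n => volume (B n)) atTop (𝓝 (volume (⋂ n, B n))) := by
      refine tendsto_measure_iInter_atTop (fun n => (hBm n).nullMeasurableSet) ?_ ⟨0, hBtop 0⟩
      intro m n hmn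
      refine Metric.closedBall_subset_closedBall ?_
      gcongr
    have h2 : ⋂ n, B n = {s} := by
      refine Set.eq_singleton_iff_unique_mem.2 ⟨Set.mem_iInter.2 fun n =>
        Metric.mem_closedBall_self (by positivity), fun y hy => ?_⟩
      have h3 : ∀ n : ℕ, dist y s ≤ 1 / ((n : ℝ) + 1) := fun n => Set.mem_iInter.1 hy n
      have h4 := ge_of_tendsto' tendsto_one_div_add_atTop_nhds_zero_nat h3
      exact dist_le_zero.1 h4
    have h5 : volume ({s} : Set Torus3) = 0 := by
      have : ({s} : Set Torus3) = Set.univ.pi fun i => Metric.closedBall (s i) 0 := by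
        ext y; simp [funext_iff]
      rw [this, volume_pi_pi]
      simp only [AddCircle.volume_closedBall]
      simp
    rw [h2, h5] at h1
    exact (ENNReal.tendsto_toReal ENNReal.zero_ne_top).comp h1
  have hintlim : Tendsto (fun n => ∫ p, ‖x n p‖) atTop (𝓝 0) := by
    simp only [hint]
    have := hVlim.rpow_const (p := (1 / 2 : ℝ)) (Or.inr (by norm_num))
    rwa [Real.zero_rpow (by norm_num)] at this
  have hmul : Tendsto (fun n => mulOp e (x n) - ((e s : ℝ) : ℂ) • x n) atTop (𝓝 0) := by
    rw [Metric.tendsto_atTop]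
    intro δ hδ
    obtain ⟨r, hr, hrδ⟩ := Metric.continuous_iff.1 e.continuous s (δ / 2) (by positivity)
    obtain ⟨N, hN⟩ := exists_nat_one_div_lt hr
    refine ⟨N, fun n hn => ?_⟩
    rw [dist_zero_right]
    have h1 : ‖mulOp e (x n) - ((e s : ℝ) : ℂ) • x n‖ ≤ δ / 2 * ‖x n‖ := by
      refine Lp.norm_le_mul_norm_of_ae_le_mul ?_
      filter_upwards [Lp.coeFn_sub (mulOp e (x n)) (((e s : ℝ) : ℂ) • x n), mulOp_ae e (x n),
        Lp.coeFn_smul ((e s : ℝ) : ℂ) (x n), hxae n] with p h2 h3 h4 h5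
      rw [h2, Pi.sub_apply, h3, h4, Pi.smul_apply, smul_eq_mul, ← sub_mul, norm_mul,
        ← Complex.ofReal_sub, Complex.norm_real]
      by_cases hp : p ∈ B n
      · gcongr
        rw [← dist_eq_norm]
        refine (hrδ p ?_).le
        refine (Metric.mem_closedBall.1 hp).trans_lt (lt_of_le_of_lt ?_ hN)
        gcongr
      · rw [h5, Set.indicator_of_notMem hp]
        simp
    rw [hx1] at h1
    linarith
  have hpot : Tendsto (fun n => potentialOp v (x n)) atTop (𝓝 0) := by
    obtain ⟨C, hC⟩ := exists_norm_potentialOp_le v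
    refine squeeze_zero_norm (fun n => hC (x n)) ?_
    simpa using hintlim.const_mul C
  refine mem_essentialSpectrum_of_singular_sequence (isSelfAdjoint_hamiltonian e hv) x hx1 ?_ ?_
  · have h1 := hmul.add hpot
    rw [add_zero] at h1
    refine h1.congr fun n => ?_
    change _ = mulOp e (x n) + potentialOp v (x n) - _
    abel
  -- A limit in `L²` is also one in `L¹`, so it would have to be `0`, against the unit norms.
  · intro y φ hφ hy
    obtain ⟨C, hC⟩ := exists_integral_norm_le
    have h1 : ∀ n, ∫ p, ‖y p‖ ≤ C * ‖y - x (φ n)‖ + ∫ p, ‖x (φ n) p‖ := by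
      intro n
      refine le_trans ?_ (add_le_add_left (hC (y - x (φ n))) _)
      rw [← integral_add (integrable_of_L2T _).norm (integrable_of_L2T _).norm]
      refine integral_mono_ae (integrable_of_L2T _).norm
        ((integrable_of_L2T _).norm.add (integrable_of_L2T _).norm) ?_
      filter_upwards [Lp.coeFn_sub y (x (φ n))] with p hp
      rw [hp, Pi.sub_apply]
      simpa using norm_add_le (y p - x (φ n) p) (x (φ n) p)
    have h2 : Tendsto (fun n => C * ‖y - x (φ n)‖ + ∫ p, ‖x (φ n) p‖) atTop (𝓝 0) := by
      have h3 : Tendsto (fun n => C * ‖y - x (φ n)‖) atTop (𝓝 (C * ‖y - y‖)) :=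
        ((tendsto_const_nhds.sub hy).norm).const_mul C
      simpa using h3.add (hintlim.comp hφ.tendsto_atTop)
    have h4 : ∫ p, ‖y p‖ ≤ 0 := ge_of_tendsto' h2 h1
    have h5 := (integral_eq_zero_iff_of_nonneg (fun p => norm_nonneg (y p))
      (integrable_of_L2T y).norm).1 (le_antisymm h4 (integral_nonneg fun p => norm_nonneg _))
    have h6 : y = 0 := by
      refine Lp.ext ?_
      filter_upwards [h5, Lp.coeFn_zero ℂ 2 (volume : Measure Torus3)] with p h7 h8
      rw [h8]
      simpa using h7
    have h9 : Tendsto (fun n => ‖x (φ n)‖) atTop (𝓝 ‖y‖) := hy.norm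
    simp only [hx1, h6, norm_zero] at h9
    exact one_ne_zero (tendsto_nhds_unique tendsto_const_nhds h9)

end Weyl

/-! ### Conditionally negative definite functions and strictness of the four-point inequality. -/

section CondNegDef

variable {ε : Torus3 → ℝ}

theorem IsCondNegDef.add_add_sub_le (h : IsCondNegDef ε) (p s : Torus3) :
    ε (p + s) + ε (p - s) ≤ 2 * ε p + 2 * ε s - 2 * ε 0 := by
  have h1 := h.2 4 ![0, p, s, p + s] ![1, -1, -1, 1] (by simp [Fin.sum_univ_four])
  have e1 : ε (-p) = ε p := h.1 p
  have e2 : ε (-s) = ε s := h.1 s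
  have e3 : ε (s - p) = ε (p - s) := by rw [← h.1 (p - s), neg_sub]
  have e5 : ε (-s + -p) = ε (p + s) := by rw [← h.1 (p + s), neg_add_rev]
  simp [Fin.sum_univ_four, e1, e2, e3, e5] at h1
  linarith

/-- `2 (ε p - ε 0)` minus the symmetric second difference of `ε` at `s` with step `p`. -/
noncomputable def defect (ε : Torus3 → ℝ) (s p : Torus3) : ℝ :=
  2 * ε p + 2 * ε s - 2 * ε 0 - ε (p + s) - ε (p - s)

theorem IsCondNegDef.defect_nonneg (h : IsCondNegDef ε) (s p : Torus3) : 0 ≤ defect ε s p := by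
  have := h.add_add_sub_le p s
  rw [defect]; linarith

theorem IsCondNegDef.defect_zero (h : IsCondNegDef ε) (s : Torus3) : defect ε s 0 = 0 := by
  rw [defect, zero_add, zero_sub, h.1 s]; ring

theorem IsCondNegDef.isCondNegDef_defect (h : IsCondNegDef ε) (s : Torus3) : IsCondNegDef (defect ε s) := by
  refine ⟨fun p => ?_, fun n p z hz => ?_⟩
  · have e1 : ε (-p + s) = ε (p - s) := by rw [← h.1 (p - s), neg_sub]; congr 1; abel
    have e2 : ε (-p - s) = ε (p + s) := by rw [← h.1 (p + s)]; congr 1; abel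
    rw [defect, defect, h.1 p, e1, e2]; ring
  -- Doubling the points to `p i` and `p i + s` with weights `z i` and `-z i` produces the second
  -- difference; the constant `2 ε s - 2 ε 0` contributes nothing because the `z i` sum to zero.
  · have h1 := h.2 (n + n) (Fin.append p fun i => p i + s) (Fin.append z fun i => -z i)
      (by simp only [Fin.sum_univ_add, Fin.append_left, Fin.append_right]; simp)
    simp only [Fin.sum_univ_add, Fin.append_left, Fin.append_right, add_sub_add_right_eq_sub] at h1
    have h2 : ∑ i, ∑ j, ((2 * ε s - 2 * ε 0 : ℝ) : ℂ) * z i * (starRingEnd ℂ) (z j) = 0 := by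
      simp_rw [← Finset.mul_sum, ← map_sum, hz]
      simp
    have h3 : ∑ i, ∑ j, (defect ε s (p i - p j) : ℂ) * z i * (starRingEnd ℂ) (z j) =
        (∑ i, (∑ j, (ε (p i - p j) : ℂ) * z i * (starRingEnd ℂ) (z j) +
          ∑ j, (ε (p i - (p j + s)) : ℂ) * z i * (starRingEnd ℂ) (-z j)) +
        ∑ i, (∑ j, (ε (p i + s - p j) : ℂ) * (-z i) * (starRingEnd ℂ) (z j) +
          ∑ j, (ε (p i - p j) : ℂ) * (-z i) * (starRingEnd ℂ) (-z j))) +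
        ∑ i, ∑ j, ((2 * ε s - 2 * ε 0 : ℝ) : ℂ) * z i * (starRingEnd ℂ) (z j) := by
      simp only [← Finset.sum_add_distrib]
      refine Finset.sum_congr rfl fun i _ => Finset.sum_congr rfl fun j _ => ?_
      have e1 : p i - (p j + s) = p i - p j - s := by abel
      have e2 : p i + s - p j = p i - p j + s := by abel
      rw [defect, e1, e2]
      push_cast
      simp only [map_neg]
      ring
    rw [h3, h2, add_zero]
    exact h1

/-- The zero set of a nonnegative conditionally negative definite function vanishing at the
origin is a subgroup. -/
def IsCondNegDef.zeroSubgroup (h : IsCondNegDef ε) (h0 : ε 0 = 0) (hpos : ∀ p, 0 ≤ ε p) :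
    AddSubgroup Torus3 where
  carrier := {p | ε p = 0}
  zero_mem' := h0
  neg_mem' := fun {p} hp => by
    change ε (-p) = 0
    rw [h.1 p]; exact hp
  add_mem' := fun {p q} hp hq => by
    have h1 := h.add_add_sub_le p q
    have hp' : ε p = 0 := hp
    have hq' : ε q = 0 := hq
    have h2 := hpos (p + q)
    have h3 := hpos (p - q)
    change ε (p + q) = 0
    linarith

/-- By Steinhaus, a closed subgroup of positive measure contains a neighbourhood of `0`, hence is
open, hence is the whole connected torus. -/
theorem IsCondNegDef.ae_ne_zero (h : IsCondNegDef ε) (hc : Continuous ε) (h0 : ε 0 = 0)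
    (hpos : ∀ p, 0 ≤ ε p) (hne : ∃ p, ε p ≠ 0) : ∀ᵐ p : Torus3, ε p ≠ 0 := by
  set K := h.zeroSubgroup h0 hpos with hK
  have hKmem : ∀ p, p ∈ K ↔ ε p = 0 := fun p => Iff.rfl
  have hclosed : IsClosed (K : Set Torus3) := isClosed_eq hc continuous_const
  have hnull : volume (K : Set Torus3) = 0 := by
    by_contra hvol
    have h1 := Measure.sub_mem_nhds_zero_of_addHaar_pos_ne_top (volume : Measure Torus3)
      (K : Set Torus3) hclosed.measurableSet (pos_iff_ne_zero.2 hvol) (measure_ne_top _ _)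
    have h2 : (K : Set Torus3) ∈ 𝓝 0 := by
      refine mem_of_superset h1 ?_
      rintro _ ⟨a, ha, b, hb, rfl⟩
      exact K.sub_mem ha hb
    have h3 : IsOpen (K : Set Torus3) := K.isOpen_of_mem_nhds h2
    have h4 := IsClopen.eq_univ ⟨hclosed, h3⟩ ⟨0, K.zero_mem⟩
    obtain ⟨p, hp⟩ := hne
    exact hp ((hKmem p).1 (h4 ▸ Set.mem_univ p : p ∈ (K : Set Torus3)))
  rw [ae_iff]
  convert hnull using 2
  ext p
  simp [hKmem]

theorem IsCondNegDef.ae_defect_pos (h : IsCondNegDef ε) (hc : Continuous ε) {s : Torus3}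
    (hs : ε s ≠ ε 0) : ∀ᵐ p : Torus3, 0 < defect ε s p := by
  have hcont : Continuous (defect ε s) := by
    unfold defect; fun_prop
  have h1 := (h.isCondNegDef_defect s).ae_ne_zero hcont (h.defect_zero s) (h.defect_nonneg s) ?_
  · filter_upwards [h1] with p hp
    exact lt_of_le_of_ne (h.defect_nonneg s p) hp.symm
  · by_contra! hall
    have hi : ∀ g : Torus3 → ℝ, Continuous g → Integrable g := fun g hg =>
      hg.integrable_of_hasCompactSupport (HasCompactSupport.of_compactSpace _)
    -- By translation invariance the terms in `ε p`, `ε (p + s)` and `ε (p - s)` cancel in the mean.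
    have h2 : ∫ p, defect ε s p =
        (2 * ε s - 2 * ε 0) * volume.real (Set.univ : Set Torus3) := by
      have e1 : ∀ p, defect ε s p =
          2 * ε p + (2 * ε s - 2 * ε 0) - ε (p + s) - ε (p - s) := fun p => by
        rw [defect]; ring
      simp_rw [e1]
      rw [integral_sub (hi _ (by fun_prop)) (hi _ (by fun_prop)),
        integral_sub (hi _ (by fun_prop)) (hi _ (by fun_prop)),
        integral_add (hi _ (by fun_prop)) (hi _ (by fun_prop)),
        integral_add_right_eq_self, integral_sub_right_eq_self, integral_const_mul]
      simp
      ring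
    simp only [hall, integral_zero] at h2
    have h3 : volume.real (Set.univ : Set Torus3) ≠ 0 :=
      ENNReal.toReal_ne_zero.2 ⟨(isOpen_univ.measure_pos _ Set.univ_nonempty).ne',
        measure_ne_top _ _⟩
    have h4 := (mul_eq_zero.1 h2.symm).resolve_right h3
    exact hs (by linarith)

end CondNegDef

/-! ### Integrability of the inverse excess energy. -/

section Threshold

/-- Representatives in `[-π/2, π/2]` can be doubled without wrapping around the circle. -/
theorem two_mul_norm_le_norm_add_self {p : Torus3} (hp : ‖p‖ ≤ Real.pi / 2) :
    2 * ‖p‖ ≤ ‖p + p‖ := by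
  have h1 : ∀ i, 2 * ‖p i‖ ≤ ‖p + p‖ := by
    intro i
    refine le_trans ?_ (norm_le_pi_norm (p + p) i)
    have hi : ‖p i‖ ≤ Real.pi / 2 := (norm_le_pi_norm p i).trans hp
    rw [Pi.add_apply]
    obtain ⟨x, hx, hxp⟩ : ∃ x ∈ Set.Ioc (-Real.pi) (-Real.pi + 2 * Real.pi),
        (x : AddCircle (2 * Real.pi)) = p i := by
      have := AddCircle.coe_image_Ioc_eq (2 * Real.pi) (-Real.pi)
      exact (this ▸ Set.mem_univ (p i) : p i ∈ _ '' _)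
    have hpi := Real.pi_pos
    have h2pi : |2 * Real.pi| / 2 = Real.pi := by rw [abs_of_pos Real.two_pi_pos]; ring
    have e1 : ‖p i‖ = |x| := by
      rw [← hxp, AddCircle.norm_coe_eq_abs_iff _ Real.two_pi_pos.ne', h2pi, abs_le]
      constructor <;> linarith [hx.1, hx.2]
    have e2 : ‖p i + p i‖ = |x + x| := by
      rw [← hxp, ← AddCircle.coe_add, AddCircle.norm_coe_eq_abs_iff _ Real.two_pi_pos.ne', h2pi,
        ← two_mul, abs_mul, abs_two, ← e1]
      linarith
    rw [e1, e2, ← two_mul, abs_mul, abs_two]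
  have h2 : ‖p‖ ≤ ‖p + p‖ / 2 :=
    (pi_norm_le_iff_of_nonneg (by positivity)).2 fun i => by linarith [h1 i]
  linarith

theorem norm_le_pi (p : Torus3) : ‖p‖ ≤ Real.pi := by
  refine (pi_norm_le_iff_of_nonneg Real.pi_pos.le).2 fun i => ?_
  have := AddCircle.norm_le_half_period (2 * Real.pi) (x := p i) Real.two_pi_pos.ne'
  rw [abs_of_pos Real.two_pi_pos] at this
  linarith

/-- Compactness bounds `g` below by some `m` where `‖p‖ ≥ π/2`, and `‖p‖ ≤ π` turns this into the
constant `m / π²`. Nearer the origin, doubling `p` doubles the norm and at most quadruples `g`, so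
the bound descends through dyadic shells. -/
theorem exists_quadratic_lower_bound {g : Torus3 → ℝ} (hg : Continuous g)
    (hpos : ∀ p, p ≠ 0 → 0 < g p) (h0 : g 0 = 0) (hdouble : ∀ p, g (p + p) ≤ 4 * g p) :
    ∃ c > 0, ∀ p, c * ‖p‖ ^ 2 ≤ g p := by
  have hpi := Real.pi_pos
  have hcomp : IsCompact {p : Torus3 | Real.pi / 2 ≤ ‖p‖} :=
    (isClosed_le continuous_const continuous_norm).isCompact
  obtain ⟨m, hm, hmin⟩ : ∃ m > 0, ∀ p : Torus3, Real.pi / 2 ≤ ‖p‖ → m ≤ g p := by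
    rcases Set.eq_empty_or_nonempty {p : Torus3 | Real.pi / 2 ≤ ‖p‖} with he | hne
    · refine ⟨1, one_pos, fun p hp => ?_⟩
      have : p ∈ {p : Torus3 | Real.pi / 2 ≤ ‖p‖} := hp
      simp [he] at this
    · obtain ⟨q, hq, hqmin⟩ := hcomp.exists_isMinOn hne hg.continuousOn
      refine ⟨g q, hpos q ?_, fun p hp => hqmin hp⟩
      rintro rfl
      have : Real.pi / 2 ≤ ‖(0 : Torus3)‖ := hq
      rw [norm_zero] at this
      linarith
  refine ⟨m / Real.pi ^ 2, by positivity, fun p => ?_⟩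
  have key : ∀ n : ℕ, ∀ p : Torus3, Real.pi / 2 ^ (n + 1) ≤ ‖p‖ →
      m / Real.pi ^ 2 * ‖p‖ ^ 2 ≤ g p := by
    intro n
    induction n with
    | zero =>
      intro p hp
      refine le_trans ?_ (hmin p (by simpa using hp))
      rw [div_mul_eq_mul_div, div_le_iff₀ (by positivity)]
      have := norm_le_pi p
      gcongr
    | succ n ih =>
      intro p hp
      rcases le_total (Real.pi / 2) ‖p‖ with hbig | hsmall
      · refine le_trans ?_ (hmin p hbig)
        rw [div_mul_eq_mul_div, div_le_iff₀ (by positivity)]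
        have := norm_le_pi p
        gcongr
      · have h1 := two_mul_norm_le_norm_add_self hsmall
        have h2 := ih (p + p) (by
          refine le_trans ?_ h1
          rw [pow_succ, ← div_div, div_le_iff₀ two_pos] at hp
          linarith)
        have h3 := hdouble p
        have h4 : m / Real.pi ^ 2 * (2 * ‖p‖) ^ 2 ≤ m / Real.pi ^ 2 * ‖p + p‖ ^ 2 := by gcongr
        nlinarith
  rcases eq_or_ne p 0 with rfl | hp
  · simp [h0]
  · have hp' : 0 < ‖p‖ := norm_pos_iff.2 hp
    obtain ⟨n, hn⟩ := pow_unbounded_of_one_lt (Real.pi / ‖p‖) one_lt_two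
    refine key n p ?_
    rw [div_lt_iff₀ hp'] at hn
    rw [div_le_iff₀ (by positivity), pow_succ]
    nlinarith [mul_pos hp' (pow_pos two_pos n)]

theorem integrable_norm_rpow_addCircle {r : ℝ} (hr : -1 < r) :
    Integrable (fun x : AddCircle (2 * Real.pi) => ‖x‖ ^ r) := by
  have hpi := Real.pi_pos
  have h1 := AddCircle.measurePreserving_mk (2 * Real.pi) (-Real.pi)
  rw [← h1.integrable_comp (Measurable.aestronglyMeasurable (by fun_prop))]
  have h2 : IntervalIntegrable (fun x : ℝ => |x| ^ r) volume 0 Real.pi := by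
    refine (intervalIntegral.intervalIntegrable_rpow' hr).congr_ae ?_
    filter_upwards [ae_restrict_mem measurableSet_uIoc] with x hx
    rw [Set.uIoc_of_le hpi.le] at hx
    rw [abs_of_pos hx.1]
  have h3 : IntervalIntegrable (fun x : ℝ => |x| ^ r) volume (-Real.pi) 0 := by
    have := IntervalIntegrable.comp_sub_left h2 0
    simpa using this.symm
  have h4 := h3.trans h2
  rw [intervalIntegrable_iff_integrableOn_Ioc_of_le (by linarith)] at h4
  have e : -Real.pi + 2 * Real.pi = Real.pi := by ring
  rw [e]
  refine h4.congr ?_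
  filter_upwards [ae_restrict_mem measurableSet_Ioc] with x hx
  have h2pi : |2 * Real.pi| / 2 = Real.pi := by rw [abs_of_pos Real.two_pi_pos]; ring
  have : ‖(x : AddCircle (2 * Real.pi))‖ = |x| := by
    rw [AddCircle.norm_coe_eq_abs_iff _ Real.two_pi_pos.ne', h2pi, abs_le]
    exact ⟨hx.1.le, hx.2⟩
  exact congrArg (· ^ r) this.symm

theorem integrable_inv_of_quadratic_lower_bound {g : Torus3 → ℝ} (hg : Continuous g) {c : ℝ}
    (hc : 0 < c) (h : ∀ p, c * ‖p‖ ^ 2 ≤ g p) : Integrable (fun p => (g p)⁻¹) := by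
  -- The exponent `-2` is shared equally among three coordinates: `‖p‖⁻² ≤ ∏ ‖p i‖^(-2/3)` for the
  -- sup norm, and `-2/3 > -1` makes each factor integrable.
  have h1 : Integrable (fun p : Torus3 => c⁻¹ * ∏ i, ‖p i‖ ^ (-(2 / 3) : ℝ)) :=
    (Integrable.fintype_prod (f := fun _ : Fin 3 => fun x : AddCircle (2 * Real.pi) =>
      ‖x‖ ^ (-(2 / 3) : ℝ)) fun _ => integrable_norm_rpow_addCircle (by norm_num)).const_mul _
  have hnull : ∀ i, ∀ᵐ p : Torus3, p i ≠ 0 := by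
    intro i
    have h2 : ∀ᵐ x : AddCircle (2 * Real.pi), x ≠ 0 := by
      rw [ae_iff]
      have : {a : AddCircle (2 * Real.pi) | ¬ a ≠ 0} = Metric.closedBall 0 0 := by
        ext a; simp
      rw [this, AddCircle.volume_closedBall]
      simp
    exact (Measure.quasiMeasurePreserving_eval
      (μ := fun _ : Fin 3 => (volume : Measure (AddCircle (2 * Real.pi)))) i).ae h2
  refine h1.mono' (by fun_prop) ?_
  filter_upwards [ae_all_iff.2 hnull] with p hp
  have hpp : ∀ i, 0 < ‖p i‖ := fun i => norm_pos_iff.2 (hp i)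
  have hn : 0 < ‖p‖ := (hpp 0).trans_le (norm_le_pi_norm p 0)
  have hgp : 0 < g p := lt_of_lt_of_le (by positivity) (h p)
  rw [Real.norm_of_nonneg (inv_nonneg.2 hgp.le)]
  have h3 : (g p)⁻¹ ≤ (c * ‖p‖ ^ 2)⁻¹ := inv_anti₀ (by positivity) (h p)
  rw [mul_inv] at h3
  refine h3.trans ?_
  gcongr
  have h4 : (‖p‖ ^ 2)⁻¹ = ∏ _i : Fin 3, ‖p‖ ^ (-(2 / 3) : ℝ) := by
    rw [Finset.prod_const, Finset.card_univ, Fintype.card_fin, ← Real.rpow_natCast,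
      ← Real.rpow_natCast, ← Real.rpow_mul hn.le, ← Real.rpow_neg hn.le]
    norm_num
  rw [h4]
  refine Finset.prod_le_prod (fun i _ => by positivity) fun i _ => ?_
  exact Real.rpow_le_rpow_of_nonpos (hpp i) (norm_le_pi_norm p i) (by norm_num)

end Threshold

/-! ### Trial functions built from a threshold state. -/

section Variational

instance isNegInvariant_addCircle :
    (volume : Measure (AddCircle (2 * Real.pi))).IsNegInvariant :=
  Measure.IsAddHaarMeasure.isNegInvariant_of_regular _

instance isNegInvariant_torus : (volume : Measure Torus3).IsNegInvariant :=
  Measure.pi.isNegInvariant _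

theorem convForm_congr {v : C(Torus3, ℂ)} {f f' g g' : Torus3 → ℂ} (hf : f =ᵐ[volume] f')
    (hg : g =ᵐ[volume] g') : convForm v f g = convForm v f' g' := by
  refine integral_congr_ae ?_
  filter_upwards [hf] with p hp
  refine integral_congr_ae ?_
  filter_upwards [hg] with q hq
  rw [hp, hq]

theorem convForm_translate (v : C(Torus3, ℂ)) (g : Torus3 → ℂ) (s : Torus3) :
    convForm v (fun p => g (p - s)) (fun p => g (p - s)) = convForm v g g := by
  have h1 : ∀ p, ∫ q, (starRingEnd ℂ) (g (p - s)) * v (p - q) * g (q - s) =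
      ∫ q, (starRingEnd ℂ) (g (p - s)) * v (p - s - q) * g q := fun p => by
    rw [← integral_sub_right_eq_self
      (fun q => (starRingEnd ℂ) (g (p - s)) * v (p - s - q) * g q) s]
    simp only [sub_sub_sub_cancel_right]
  simp only [convForm, h1]
  exact integral_sub_right_eq_self
    (fun p => ∫ q, (starRingEnd ℂ) (g p) * v (p - q) * g q) s

/-- Conjugation exchanges the roles of the two variables and `p ↦ -p` reverses `p - q`; Fubini swaps
them back. -/
theorem convForm_reflect (v : C(Torus3, ℂ)) {g : Torus3 → ℂ} (hg : Integrable g) :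
    convForm v (fun p => (starRingEnd ℂ) (g (-p))) (fun p => (starRingEnd ℂ) (g (-p))) =
      convForm v g g := by
  have h1 : ∀ p, ∫ q, (starRingEnd ℂ) ((starRingEnd ℂ) (g (-p))) * v (p - q) *
      (starRingEnd ℂ) (g (-q)) = ∫ q, g (-p) * v (q - -p) * (starRingEnd ℂ) (g q) := fun p => by
    rw [← integral_neg_eq_self (fun q => g (-p) * v (q - -p) * (starRingEnd ℂ) (g q))]
    simp only [Complex.conj_conj]
    congr 1
    ext q
    congr 3
    abel
  simp only [convForm, h1]
  rw [integral_neg_eq_self (fun p => ∫ q, g p * v (q - p) * (starRingEnd ℂ) (g q))]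
  refine Eq.trans ?_ (integral_integral_swap (integrable_convKernel v hg hg)).symm
  congr 1
  ext p
  congr 1
  ext q
  ring

theorem integrable_mul_norm_sq (e : C(Torus3, ℝ)) {g : Torus3 → ℂ} (hg : MemLp g 2) :
    Integrable (fun p => e p * ‖g p‖ ^ 2) := by
  have h1 : Integrable (fun p => ‖g p‖ ^ 2) := hg.integrable_norm_pow (by norm_num)
  exact h1.bdd_mul (c := ‖e‖) (by fun_prop) (Eventually.of_forall fun p => e.norm_coe_le_norm p)

theorem re_inner_hamiltonian (e : C(Torus3, ℝ)) (v : C(Torus3, ℂ)) {g : Torus3 → ℂ}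
    (hg : MemLp g 2) :
    (inner ℂ (hg.toLp g) (hamiltonian e v (hg.toLp g))).re =
      (∫ p, e p * ‖g p‖ ^ 2) + coupling * (convForm v g g).re := by
  have h1 : hamiltonian e v (hg.toLp g) = mulOp e (hg.toLp g) + potentialOp v (hg.toLp g) := rfl
  have h2 : inner ℂ (hg.toLp g) (mulOp e (hg.toLp g)) = ((∫ p, e p * ‖g p‖ ^ 2 : ℝ) : ℂ) := by
    rw [L2.inner_def, ← integral_complex_ofReal]
    refine integral_congr_ae ?_
    filter_upwards [mulOp_ae e (hg.toLp g), hg.coeFn_toLp] with p h3 h4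
    rw [h3, h4, RCLike.inner_apply, mul_assoc, RCLike.mul_conj]
    push_cast
    rfl
  rw [h1, inner_add_right, h2, inner_potentialOp, convForm_congr hg.coeFn_toLp hg.coeFn_toLp,
    Complex.add_re, Complex.ofReal_re, Complex.re_ofReal_mul]

theorem norm_toLp_sq {g : Torus3 → ℂ} (hg : MemLp g 2) :
    ‖hg.toLp g‖ ^ 2 = ∫ p, ‖g p‖ ^ 2 := by
  have h1 : ((‖hg.toLp g‖ ^ 2 : ℝ) : ℂ) = ((∫ p, ‖g p‖ ^ 2 : ℝ) : ℂ) := by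
    push_cast
    have h2 := inner_self_eq_norm_sq_to_K (𝕜 := ℂ) (hg.toLp g)
    refine h2.symm.trans ?_
    rw [L2.inner_def, ← integral_complex_ofReal]
    refine integral_congr_ae ?_
    filter_upwards [hg.coeFn_toLp] with p h4
    rw [h4, inner_self_eq_norm_sq_to_K]
    push_cast
    rfl
  exact_mod_cast h1

theorem exists_mem_spectrum_of_trial (e : C(Torus3, ℝ)) {v : C(Torus3, ℂ)}
    (hv : ∀ p, v p = (starRingEnd ℂ) (v (-p))) (s : Torus3) (t : ℝ) {g : Torus3 → ℂ}
    (hg : MemLp g 2)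
    (hneg : (∫ p, (e (p + s) - t) * ‖g p‖ ^ 2) + coupling * (convForm v g g).re < 0) :
    ∃ l : ℝ, l < t ∧ (l : ℂ) ∈ spectrum ℂ (hamiltonian e v) := by
  have hG : MemLp (fun p => g (p - s)) 2 :=
    hg.comp_measurePreserving (measurePreserving_sub_right volume s)
  refine exists_mem_spectrum_lt (isSelfAdjoint_hamiltonian e hv) (x := hG.toLp _) ?_
  rw [re_inner_hamiltonian, norm_toLp_sq, convForm_translate]
  have h1 : ∫ p, e p * ‖g (p - s)‖ ^ 2 = ∫ p, e (p + s) * ‖g p‖ ^ 2 := by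
    rw [← integral_sub_right_eq_self (fun p => e (p + s) * ‖g p‖ ^ 2) s]
    simp only [sub_add_cancel]
  have h2 : ∫ p, ‖g (p - s)‖ ^ 2 = ∫ p, ‖g p‖ ^ 2 :=
    integral_sub_right_eq_self (fun p => ‖g p‖ ^ 2) s
  have h3 : ∫ p, (e (p + s) - t) * ‖g p‖ ^ 2 =
      (∫ p, e (p + s) * ‖g p‖ ^ 2) - t * ∫ p, ‖g p‖ ^ 2 := by
    have hi : Integrable (fun p => e (p + s) * ‖g p‖ ^ 2) :=
      integrable_mul_norm_sq ⟨fun p => e (p + s), by fun_prop⟩ hg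
    rw [← integral_const_mul, ← integral_sub hi
      ((hg.integrable_norm_pow (by norm_num)).const_mul t)]
    simp only [sub_mul]
  rw [h1, h2]
  rw [h3] at hneg
  linarith

/-- Averaging a trial function with its reflection removes the odd part of the dispersion. -/
theorem exists_mem_spectrum_of_symmetrized_trial (e : C(Torus3, ℝ)) {v : C(Torus3, ℂ)}
    (hv : ∀ p, v p = (starRingEnd ℂ) (v (-p))) (s : Torus3) (t : ℝ) {g : Torus3 → ℂ}
    (hg : MemLp g 2)
    (hneg : (∫ p, (e (p + s) + e (s - p) - 2 * t) * ‖g p‖ ^ 2) +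
      2 * coupling * (convForm v g g).re < 0) :
    ∃ l : ℝ, l < t ∧ (l : ℂ) ∈ spectrum ℂ (hamiltonian e v) := by
  have hint : Integrable g := hg.integrable (by norm_num)
  have hr : MemLp (fun p => (starRingEnd ℂ) (g (-p))) 2 :=
    (hg.comp_measurePreserving (Measure.measurePreserving_neg volume)).star
  have h1 : ∫ p, (e (p + s) - t) * ‖(starRingEnd ℂ) (g (-p))‖ ^ 2 =
      ∫ p, (e (s - p) - t) * ‖g p‖ ^ 2 := by
    rw [← integral_neg_eq_self (fun p => (e (s - p) - t) * ‖g p‖ ^ 2)]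
    congr 1
    ext p
    rw [RCLike.norm_conj, sub_neg_eq_add, add_comm]
  have h2 : ∫ p, (e (p + s) + e (s - p) - 2 * t) * ‖g p‖ ^ 2 =
      (∫ p, (e (p + s) - t) * ‖g p‖ ^ 2) + ∫ p, (e (s - p) - t) * ‖g p‖ ^ 2 := by
    have hi₁ : Integrable (fun p => (e (p + s) - t) * ‖g p‖ ^ 2) :=
      integrable_mul_norm_sq ⟨fun p => e (p + s) - t, by fun_prop⟩ hg
    have hi₂ : Integrable (fun p => (e (s - p) - t) * ‖g p‖ ^ 2) :=
      integrable_mul_norm_sq ⟨fun p => e (s - p) - t, by fun_prop⟩ hg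
    rw [← integral_add hi₁ hi₂]
    congr 1
    ext p
    ring
  by_cases hcase : (∫ p, (e (p + s) - t) * ‖g p‖ ^ 2) + coupling * (convForm v g g).re < 0
  -- The hypothesis bounds the sum of the energies of `g` and its reflection, so at least one of the
  -- two is negative.
  · exact exists_mem_spectrum_of_trial e hv s t hg hcase
  · refine exists_mem_spectrum_of_trial e hv s t hr ?_
    rw [h1, convForm_reflect v hint]
    rw [h2] at hneg
    linarith

/-- The restriction of `f` to the set where `‖f‖ ≤ n`. -/
noncomputable def truncate (f : Torus3 → ℂ) (n : ℕ) : Torus3 → ℂ :=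
  {p | ‖f p‖ ≤ n}.indicator f

theorem norm_truncate_le (f : Torus3 → ℂ) (n : ℕ) (p : Torus3) : ‖truncate f n p‖ ≤ ‖f p‖ :=
  norm_indicator_le_norm_self _ _

theorem measurable_truncate {f : Torus3 → ℂ} (hf : Measurable f) (n : ℕ) :
    Measurable (truncate f n) :=
  hf.indicator (measurableSet_le hf.norm measurable_const)

theorem tendsto_truncate (f : Torus3 → ℂ) (p : Torus3) :
    Tendsto (fun n => truncate f n p) atTop (𝓝 (f p)) := by
  refine tendsto_const_nhds.congr' ?_
  filter_upwards [eventually_ge_atTop ⌈‖f p‖⌉₊] with n hn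
  have h1 : ‖f p‖ ≤ n := (Nat.le_ceil _).trans (Nat.cast_le.2 hn)
  exact (Set.indicator_of_mem (s := {p | ‖f p‖ ≤ n}) h1 f).symm

theorem memLp_truncate {f : Torus3 → ℂ} (hf : Measurable f) (n : ℕ) : MemLp (truncate f n) 2 := by
  refine MemLp.of_bound (measurable_truncate hf n).aestronglyMeasurable n
    (Eventually.of_forall fun p => ?_)
  by_cases hp : p ∈ {p | ‖f p‖ ≤ n}
  · rw [truncate, Set.indicator_of_mem hp]; exact hp
  · rw [truncate, Set.indicator_of_notMem hp, norm_zero]; positivity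

theorem convForm_eq_integral_prod (v : C(Torus3, ℂ)) {g : Torus3 → ℂ} (hg : Integrable g) :
    convForm v g g = ∫ z : Torus3 × Torus3,
      (starRingEnd ℂ) (g z.1) * v (z.1 - z.2) * g z.2 ∂(volume.prod volume) :=
  integral_integral (integrable_convKernel v hg hg)

theorem tendsto_convForm_truncate (v : C(Torus3, ℂ)) {f : Torus3 → ℂ} (hf : Measurable f)
    (hi : Integrable f) :
    Tendsto (fun n => convForm v (truncate f n) (truncate f n)) atTop (𝓝 (convForm v f f)) := by
  have hti : ∀ n, Integrable (truncate f n) := fun n =>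
    (memLp_truncate hf n).integrable (by norm_num)
  rw [convForm_eq_integral_prod v hi]
  simp only [fun n => convForm_eq_integral_prod v (hti n)]
  refine tendsto_integral_of_dominated_convergence
    (fun z => ‖(starRingEnd ℂ) (f z.1) * v (z.1 - z.2) * f z.2‖)
    (fun n => (integrable_convKernel v (hti n) (hti n)).aestronglyMeasurable)
    (integrable_convKernel v hi hi).norm (fun n => Eventually.of_forall fun z => ?_)
    (Eventually.of_forall fun z => ?_)
  · simp only [norm_mul, RCLike.norm_conj]
    gcongr <;> exact norm_truncate_le _ _ _
  · exact (((RCLike.continuous_conj.tendsto _).comp (tendsto_truncate f z.1)).mul_const _).mul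
      (tendsto_truncate f z.2)

/-- A threshold state: an integrable solution of `(e - e 0) f + V f = 0`. -/
structure IsThresholdState (φ : C(Torus3, ℝ)) (v : C(Torus3, ℂ)) (f : Torus3 → ℂ) : Prop where
  measurable : Measurable f
  integrable : Integrable f
  ne_zero : ¬ f =ᵐ[volume] 0
  exists_bounded : ∃ ψ : C(Torus3, ℂ), (∀ᵐ p, (φ p : ℂ) * f p = ψ p) ∧
    ∀ᵐ p, (coupling : ℂ) * ∫ q, v (p - q) * f q = -ψ p

variable {φ : C(Torus3, ℝ)} {v : C(Torus3, ℂ)} {f : Torus3 → ℂ}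

/-- `φ f` is a bounded function `ψ`, so `φ |f|²` is at most a constant times `|f|`; square
integrability of `f` is not needed. -/
theorem IsThresholdState.integrable_energy (h : IsThresholdState φ v f) :
    Integrable (fun p => φ p * ‖f p‖ ^ 2) := by
  obtain ⟨ψ, h1, -⟩ := h.exists_bounded
  have hm := h.measurable
  refine (h.integrable.norm.const_mul ‖ψ‖).mono' (by fun_prop) ?_
  filter_upwards [h1] with p hp
  have h2 : ‖φ p‖ * ‖f p‖ = ‖ψ p‖ := by rw [← hp, norm_mul, Complex.norm_real]
  rw [norm_mul, norm_pow, norm_norm, pow_two, ← mul_assoc, h2]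
  gcongr
  exact ψ.norm_coe_le_norm p

theorem IsThresholdState.coupling_mul_re_convForm (h : IsThresholdState φ v f) :
    coupling * (convForm v f f).re = -∫ p, φ p * ‖f p‖ ^ 2 := by
  obtain ⟨ψ, h1, h2⟩ := h.exists_bounded
  have h3 : (coupling : ℂ) * convForm v f f = ((-∫ p, φ p * ‖f p‖ ^ 2 : ℝ) : ℂ) := by
    rw [← integral_neg, ← integral_complex_ofReal, convForm, ← integral_const_mul]
    refine integral_congr_ae ?_
    filter_upwards [h1, h2] with p hp1 hp2
    simp only [mul_assoc]
    rw [integral_const_mul, mul_left_comm, hp2, ← hp1]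
    have h4 : (starRingEnd ℂ) (f p) * f p = ((‖f p‖ : ℝ) : ℂ) ^ 2 := RCLike.conj_mul (f p)
    rw [mul_neg, mul_left_comm, h4]
    push_cast
    rfl
  have := congrArg Complex.re h3
  rwa [Complex.re_ofReal_mul, Complex.ofReal_re] at this

/-- The threshold equation replaces the interaction energy of `f` by `-∫ φ |f|²`, so the symmetrised
form is strictly negative. The second difference `S` is nonnegative at a minimum, which lets `2 φ
|f|²` dominate `S |f|²`. -/
theorem IsThresholdState.exists_mem_spectrum_lt (h : IsThresholdState φ v f)
    (hv : ∀ p, v p = (starRingEnd ℂ) (v (-p))) (e : C(Torus3, ℝ)) (s : Torus3)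
    (hmin : ∀ p, e s ≤ e p) (hle : ∀ᵐ p, e (p + s) + e (s - p) - 2 * e s < 2 * φ p) :
    ∃ l : ℝ, l < e s ∧ (l : ℂ) ∈ spectrum ℂ (hamiltonian e v) := by
  have hm := h.measurable
  let S : Torus3 → ℝ := fun p => e (p + s) + e (s - p) - 2 * e s
  have hS0 : ∀ p, 0 ≤ S p := fun p => by
    have h1 := hmin (p + s)
    have h2 := hmin (s - p)
    simp only [S]; linarith
  have hScont : Continuous S := by fun_prop
  have hE : Integrable (fun p => 2 * (φ p * ‖f p‖ ^ 2)) := h.integrable_energy.const_mul 2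
  have hbound : ∀ᵐ p, ‖S p * ‖f p‖ ^ 2‖ ≤ 2 * (φ p * ‖f p‖ ^ 2) := by
    filter_upwards [hle] with p hp
    rw [norm_mul, Real.norm_of_nonneg (hS0 p), Real.norm_of_nonneg (by positivity), ← mul_assoc]
    gcongr
  have hSi : Integrable (fun p => S p * ‖f p‖ ^ 2) :=
    hE.mono' (by fun_prop) hbound
  have hlt : (∫ p, S p * ‖f p‖ ^ 2) + 2 * coupling * (convForm v f f).re < 0 := by
    rw [mul_assoc, h.coupling_mul_re_convForm, mul_neg, ← sub_eq_add_neg, ← integral_const_mul,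
      ← integral_sub hSi hE]
    have hnn : ∀ᵐ p, 0 ≤ 2 * (φ p * ‖f p‖ ^ 2) - S p * ‖f p‖ ^ 2 := by
      filter_upwards [hle] with p hp
      have : 0 ≤ (2 * φ p - S p) * ‖f p‖ ^ 2 := mul_nonneg (sub_pos.2 hp).le (by positivity)
      linarith
    have h1 : 0 < ∫ p, (2 * (φ p * ‖f p‖ ^ 2) - S p * ‖f p‖ ^ 2) := by
      refine lt_of_le_of_ne (integral_nonneg_of_ae hnn) fun h0 => h.ne_zero ?_
      have h2 := (integral_eq_zero_iff_of_nonneg_ae hnn (hE.sub hSi)).1 h0.symm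
      filter_upwards [h2, hle] with p hp1 hp2
      have h3 : (2 * φ p - S p) * ‖f p‖ ^ 2 = 0 := by
        have : 2 * (φ p * ‖f p‖ ^ 2) - S p * ‖f p‖ ^ 2 = 0 := hp1
        linarith
      simpa using (mul_eq_zero.1 h3).resolve_left (sub_pos.2 hp2).ne'
    have h4 : ∫ p, (S p * ‖f p‖ ^ 2 - 2 * (φ p * ‖f p‖ ^ 2)) =
        -∫ p, (2 * (φ p * ‖f p‖ ^ 2) - S p * ‖f p‖ ^ 2) := by
      rw [← integral_neg]
      simp only [neg_sub]
    rw [h4]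
    linarith
  -- As `f` may fail to be in `L²`, strict negativity is passed to a bounded truncation by dominated
  -- convergence in both terms.
  have hlim1 : Tendsto (fun n => ∫ p, S p * ‖truncate f n p‖ ^ 2) atTop
      (𝓝 (∫ p, S p * ‖f p‖ ^ 2)) := by
    refine tendsto_integral_of_dominated_convergence (fun p => 2 * (φ p * ‖f p‖ ^ 2))
      (fun n => ?_) hE (fun n => ?_) (Eventually.of_forall fun p => ?_)
    · have := measurable_truncate hm n
      fun_prop
    · filter_upwards [hbound] with p hp
      refine le_trans ?_ hp
      simp only [norm_mul, norm_pow, norm_norm]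
      gcongr
      exact norm_truncate_le _ _ _
    · exact (((tendsto_truncate f p).norm).pow 2).const_mul _
  have hlim2 : Tendsto (fun n => (convForm v (truncate f n) (truncate f n)).re) atTop
      (𝓝 (convForm v f f).re) :=
    (Complex.continuous_re.tendsto _).comp (tendsto_convForm_truncate v hm h.integrable)
  have hlim := hlim1.add (hlim2.const_mul (2 * coupling))
  obtain ⟨n, hn⟩ := (hlim.eventually (gt_mem_nhds hlt)).exists
  exact exists_mem_spectrum_of_symmetrized_trial e hv s (e s) (memLp_truncate hm n) hn

end Variational

/-! ### Threshold states from the hypotheses, and the strict comparison of dispersions. -/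

section Main

variable {ε₁ ε₂ : C(Torus3, ℝ)}

/-- `ℰ₀ - ℰ₀(0)`. -/
noncomputable def excessEnergy (ε₁ ε₂ : C(Torus3, ℝ)) : C(Torus3, ℝ) :=
  twoParticle ε₁ ε₂ 0 - ContinuousMap.const _ (twoParticle ε₁ ε₂ 0 0)

theorem excessEnergy_eq (h₂ : IsCondNegDef ε₂) (p : Torus3) :
    excessEnergy ε₁ ε₂ p = (ε₁ p - ε₁ 0) + (ε₂ p - ε₂ 0) := by
  change (ε₁ p + ε₂ (0 - p)) - (ε₁ 0 + ε₂ (0 - 0)) = _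
  rw [zero_sub, zero_sub, neg_zero, h₂.1 p]
  ring

theorem excessEnergy_pos (hε₁ : IsDispersion ε₁) (hε₂ : IsDispersion ε₂) (h₂ : IsCondNegDef ε₂)
    {p : Torus3} (hp : p ≠ 0) : 0 < excessEnergy ε₁ ε₂ p := by
  have h3 := hε₁.unique_min p hp
  have h4 := hε₂.unique_min p hp
  rw [excessEnergy_eq h₂]
  linarith

theorem integrable_inv_excessEnergy (hε₁ : IsDispersion ε₁) (hε₂ : IsDispersion ε₂)
    (h₁ : IsCondNegDef ε₁) (h₂ : IsCondNegDef ε₂) :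
    Integrable (fun p => (excessEnergy ε₁ ε₂ p)⁻¹) := by
  obtain ⟨c, hc, h⟩ := exists_quadratic_lower_bound (excessEnergy ε₁ ε₂).continuous
    (fun p hp => excessEnergy_pos hε₁ hε₂ h₂ hp) (by rw [excessEnergy_eq h₂]; ring) (fun p => by
      have h3 := h₁.add_add_sub_le p p
      have h4 := h₂.add_add_sub_le p p
      rw [sub_self] at h3 h4
      rw [excessEnergy_eq h₂, excessEnergy_eq h₂]
      linarith)
  exact integrable_inv_of_quadratic_lower_bound (excessEnergy ε₁ ε₂).continuous hc h

theorem ae_ne_zero_torus : ∀ᵐ p : Torus3, p ≠ 0 := by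
  rw [ae_iff]
  have : {p : Torus3 | ¬ p ≠ 0} = Set.univ.pi fun _ => Metric.closedBall 0 0 := by
    ext y; simp [funext_iff]
  rw [this, volume_pi_pi]
  simp only [AddCircle.volume_closedBall]
  simp

theorem HasThresholdEigenvalue.exists_isThresholdState {v : C(Torus3, ℂ)}
    (h : HasThresholdEigenvalue (twoParticle ε₁ ε₂ 0) v) :
    ∃ f, IsThresholdState (excessEnergy ε₁ ε₂) v f := by
  obtain ⟨f, hf⟩ := h.exists_hasEigenvector
  have hev : hamiltonian (twoParticle ε₁ ε₂ 0) v f = ((twoParticle ε₁ ε₂ 0 0 : ℝ) : ℂ) • f :=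
    hf.apply_eq_smul
  refine ⟨f, (Lp.stronglyMeasurable f).measurable, integrable_of_L2T f, fun h0 => hf.2 ?_,
    -- The continuous representative of `φ f` is `-V f`, by the eigenvalue equation.
    -((coupling : ℂ) • convC v f), ?_, Eventually.of_forall fun p => ?_⟩
  · refine Lp.ext ?_
    filter_upwards [h0, Lp.coeFn_zero ℂ 2 (volume : Measure Torus3)] with p h1 h2
    rw [h1, h2]
  · have h1 := hamiltonian_ae (twoParticle ε₁ ε₂ 0) v f
    rw [hev] at h1
    filter_upwards [h1, Lp.coeFn_smul ((twoParticle ε₁ ε₂ 0 0 : ℝ) : ℂ) f] with p h2 h3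
    rw [h3, Pi.smul_apply, smul_eq_mul] at h2
    change ((twoParticle ε₁ ε₂ 0 p - twoParticle ε₁ ε₂ 0 0 : ℝ) : ℂ) * f p =
      -((coupling : ℂ) * convAt v p f)
    rw [convAt_eq, coupling]
    push_cast at h2 ⊢
    linear_combination -h2
  · change _ = - -((coupling : ℂ) * convAt v p f)
    rw [convAt_eq, neg_neg]

theorem HasVirtualLevel.exists_isThresholdState {v : C(Torus3, ℂ)} (hε₁ : IsDispersion ε₁)
    (hε₂ : IsDispersion ε₂) (h₁ : IsCondNegDef ε₁) (h₂ : IsCondNegDef ε₂)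
    (h : HasVirtualLevel (twoParticle ε₁ ε₂ 0) v) :
    ∃ f, IsThresholdState (excessEnergy ε₁ ε₂) v f := by
  obtain ⟨ψ, hψ, hBS, -⟩ := h
  set φ := excessEnergy ε₁ ε₂ with hφ
  have hφ0 : ∀ p ≠ 0, (φ p : ℂ) ≠ 0 := fun p hp =>
    Complex.ofReal_ne_zero.2 (excessEnergy_pos hε₁ hε₂ h₂ hp).ne'
  have hmul : ∀ᵐ p, (φ p : ℂ) * ((((φ p)⁻¹ : ℝ) : ℂ) * ψ p) = ψ p := by
    filter_upwards [ae_ne_zero_torus] with p hp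
    rw [Complex.ofReal_inv, mul_inv_cancel_left₀ (hφ0 p hp)]
  have hmeas : Measurable fun p => (((φ p)⁻¹ : ℝ) : ℂ) * ψ p := by
    have h3 := φ.continuous.measurable
    have h4 := ψ.continuous.measurable
    fun_prop
  refine ⟨fun p => (((φ p)⁻¹ : ℝ) : ℂ) * ψ p, hmeas, ?_, fun h0 => hψ ?_, ψ, hmul,
    Eventually.of_forall fun p => ?_⟩
  -- The state is `f = ψ / φ`, with the junk value `0` at the origin, which is a null set.
  · refine ((integrable_inv_excessEnergy hε₁ hε₂ h₁ h₂).norm.mul_const ‖ψ‖).mono'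
      hmeas.aestronglyMeasurable (Eventually.of_forall fun p => ?_)
    rw [norm_mul, Complex.norm_real]
    gcongr
    exact ψ.norm_coe_le_norm p
  · have h3 : (ψ : Torus3 → ℂ) =ᵐ[volume] fun _ => 0 := by
      filter_upwards [hmul, h0] with p h4 h5
      rw [← h4, h5, Pi.zero_apply, mul_zero]
    exact DFunLike.coe_injective
      ((Continuous.ae_eq_iff_eq volume ψ.continuous continuous_const).1 h3)
  · rw [← hBS p, birmanSchwinger, ← integral_const_mul]
    congr 1
    ext q
    change _ = (coupling : ℂ) * v (p - q) * (((φ q)⁻¹ : ℝ) : ℂ) * ψ q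
    ring

theorem mem_discreteSpectrum_hamiltonian (e : C(Torus3, ℝ)) {v : C(Torus3, ℂ)}
    (hv : ∀ p, v p = (starRingEnd ℂ) (v (-p))) {l : ℝ} (hl : ∀ p, l < e p)
    (hspec : (l : ℂ) ∈ spectrum ℂ (hamiltonian e v)) :
    (l : ℂ) ∈ discreteSpectrum (hamiltonian e v) :=
  mem_discreteSpectrum_of_hasCompactApproxEigenvectors (isSelfAdjoint_hamiltonian e hv)
    (hasCompactApproxEigenvectors_hamiltonian e v hl) hspec

theorem ae_second_difference_lt (hε₁ : IsDispersion ε₁) (hε₂ : IsDispersion ε₂)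
    (h₁ : IsCondNegDef ε₁) (h₂ : IsCondNegDef ε₂) {k : Torus3} (hk : k ≠ 0) (s : Torus3) :
    ∀ᵐ p, twoParticle ε₁ ε₂ k (p + s) + twoParticle ε₁ ε₂ k (s - p) -
      2 * twoParticle ε₁ ε₂ k s < 2 * excessEnergy ε₁ ε₂ p := by
  have hpos : ∀ᵐ p, 0 < defect ε₁ s p + defect ε₂ (k - s) p := by
    -- If `s = 0`, then `k - s = k ≠ 0` and the defect of `ε₂` is the strict one; otherwise that of
    -- `ε₁` is.
    rcases eq_or_ne s 0 with rfl | hs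
    · filter_upwards [h₂.ae_defect_pos ε₂.continuous
        (hε₂.unique_min (k - 0) (by rwa [sub_zero])).ne'] with p hp
      exact add_pos_of_nonneg_of_pos (h₁.defect_nonneg _ p) hp
    · filter_upwards [h₁.ae_defect_pos ε₁.continuous (hε₁.unique_min s hs).ne'] with p hp
      exact add_pos_of_pos_of_nonneg hp (h₂.defect_nonneg _ p)
  filter_upwards [hpos] with p hp
  rw [excessEnergy_eq h₂]
  change (ε₁ (p + s) + ε₂ (k - (p + s))) + (ε₁ (s - p) + ε₂ (k - (s - p))) -
    2 * (ε₁ s + ε₂ (k - s)) < _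
  have e1 : ε₁ (s - p) = ε₁ (p - s) := by rw [← h₁.1 (p - s), neg_sub]
  have e2 : ε₂ (k - (p + s)) = ε₂ (p - (k - s)) := by
    rw [← h₂.1 (p - (k - s))]; congr 1; abel
  have e3 : k - (s - p) = p + (k - s) := by abel
  rw [e1, e2, e3]
  simp only [defect] at hp
  linarith

end Main

end LatticeTwoBody

theorem theorem5p2
    (ε₁ ε₂ : C(LatticeTwoBody.Torus3, ℝ)) (v : C(LatticeTwoBody.Torus3, ℂ))
    (hε₁ : LatticeTwoBody.IsDispersion ε₁) (hε₂ : LatticeTwoBody.IsDispersion ε₂)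
    (hcnd₁ : LatticeTwoBody.IsCondNegDef ε₁) (hcnd₂ : LatticeTwoBody.IsCondNegDef ε₂)
    (hv : ∀ p, v p = (starRingEnd ℂ) (v (-p)))
    (hthr : LatticeTwoBody.HasThresholdEigenvalue (LatticeTwoBody.twoParticle ε₁ ε₂ 0) v ∨
      LatticeTwoBody.HasVirtualLevel (LatticeTwoBody.twoParticle ε₁ ε₂ 0) v)
    (k : LatticeTwoBody.Torus3) (hk : k ≠ 0) :
    IsLeast {l : ℝ | (l : ℂ) ∈
        LatticeTwoBody.essentialSpectrum (LatticeTwoBody.fiber ε₁ ε₂ v k)}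
      (LatticeTwoBody.energyMin ε₁ ε₂ k) ∧
    ∃ l : ℝ, l < LatticeTwoBody.energyMin ε₁ ε₂ k ∧
      (l : ℂ) ∈ LatticeTwoBody.discreteSpectrum (LatticeTwoBody.fiber ε₁ ε₂ v k) := by
  open LatticeTwoBody in
  set e := twoParticle ε₁ ε₂ k with he
  obtain ⟨s, -, hs⟩ := isCompact_univ.exists_isMinOn Set.univ_nonempty e.continuous.continuousOn
  have hmin : ∀ p, e s ≤ e p := fun p => hs (Set.mem_univ p)
  have hE : energyMin ε₁ ε₂ k = e s :=
    le_antisymm (ciInf_le ⟨e s, Set.forall_mem_range.2 hmin⟩ s) (le_ciInf hmin)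
  have hdisc : ∀ l : ℝ, l < e s → (l : ℂ) ∈ spectrum ℂ (fiber ε₁ ε₂ v k) →
      (l : ℂ) ∈ discreteSpectrum (fiber ε₁ ε₂ v k) := fun l hl =>
    mem_discreteSpectrum_hamiltonian e hv fun p => hl.trans_le (hmin p)
  rw [hE]
  refine ⟨⟨mem_essentialSpectrum_hamiltonian e hv s, fun l hl => ?_⟩, ?_⟩
  · by_contra! hlt
    exact hl.2 (hdisc l hlt hl.1)
  · obtain ⟨f, hf⟩ := hthr.elim HasThresholdEigenvalue.exists_isThresholdState
      (HasVirtualLevel.exists_isThresholdState hε₁ hε₂ hcnd₁ hcnd₂)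
    obtain ⟨l, hl, hspec⟩ := hf.exists_mem_spectrum_lt hv e s hmin
      (ae_second_difference_lt hε₁ hε₂ hcnd₁ hcnd₂ hk s)
    exact ⟨l, hl, hdisc l hl hspec⟩
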